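/- Let $\mathcal A\subset\mathbb R$ be a non-empty open interval. For $\rho>0$ let $S(\rho,\mathcal A)=\{|\zeta|<\rho\}\cup\{r e^{i\theta} : r>0,\ \theta\in\mathcal A\}$, and for $\tau\in\mathbb R$ let $\Sigma^{\mathcal A}_\tau=\bigcup_{\theta\in\mathcal A}\{z : \operatorname{Re}(z e^{i\theta})>\tau\}$. The union is taken in $\mathbb C$ if $\tau<0$ or $\mathcal A$ has length less than $\pi$; otherwise it is taken in the Riemann surface of the logarithm, the half-plane of direction $\theta$ being placed over $-\theta-\frac\pi2<\arg z<-\theta+\frac\pi2$. For $\tau<0\le\tau'$, points of $\Sigma^{\mathcal A}_{\tau'}$ are projected to $\Sigma^{\mathcal A}_\tau\subset\mathbb C$ where needed. For $\tilde\phi(z)=c+\sum_{n\ge0}a_nz^{-n-1}\in\mathbb C[[z^{-1}]]$ let $\hat\varphi(\zeta)=\sum_{n\ge 0} a_n\zeta^n/n!$ be its formal Borel transform. If $\hat\varphi$ converges near $0$ and extends holomorphically to $S(\rho,\mathcal A)$, put $\|\tilde\phi\|_{\rho,\tau}=|c|+\sup_{\zeta\in S(\rho,\mathcal A)}e^{-\tau|\zeta|}|\hat\varphi(\zeta)|\in[0,\infty]$;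 otherwise put $\|\tilde\phi\|_{\rho,\tau}=\infty$. The series $\tilde\phi$ is called $1$-summable in the directions of $\mathcal A$ if $\|\tilde\phi\|_{\rho,\tau}<\infty$ for some $\rho>0$ and $\tau\in\mathbb R$. Its Borel sum is then the function on $\Sigma^{\mathcal A}_\tau$ given by $$(\operatorname{Sum}^{\mathcal A}\tilde\phi)(z)=c+\int_0^{e^{i\theta}\infty}\hat\varphi(\zeta)e^{-z\zeta}\,d\zeta$$ for any $\theta\in\mathcal A$ such that $z$ lies in the half-plane of direction $\theta$. **Theorem.** Let $\tilde H=\sum_{k\in\mathbb N^r}\tilde H_k(z)\,w_1^{k_1}\cdots w_r^{k_r}\in\mathbb C[[z^{-1},w_1,\dots,w_r]]$ have coefficients that are $1$-summable in the directions of $\mathcal A$, and suppose that $\|\tilde H_k\|_{\rho,\tau}\le A B^{|k|}$ for all $k\in\mathbb N^r$, where $\rho,A,B>0$ and $\tau\in\mathbb R$ do not depend on $k$, and $|k|=k_1+\cdots+k_r$. Then: 1. The Borel sums $\operatorname{Sum}^{\mathcal A}\tilde H_k$ are well defined on $\Sigma^{\mathcal A}_\tau$ (the Laplace integrals converge and do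 not depend on the choice of $\theta$), and the series $$\mathcal H^{\mathcal A}(z,w_1,\dots,w_r)=\sum_{k\in\mathbb N^r}(\operatorname{Sum}^{\mathcal A}\tilde H_k)(z)\,w_1^{k_1}\cdots w_r^{k_r}$$ converges to a holomorphic function on $\Sigma^{\mathcal A}_\tau\times\{|w_1|<1/B\}\times\cdots\times\{|w_r|<1/B\}$. 2. Let $\tilde\varphi_1,\dots,\tilde\varphi_r$ be series without constant term that are $1$-summable in the directions of $\mathcal A$. Then $\tilde H(\tilde\varphi_1,\dots,\tilde\varphi_r)=\sum_k\tilde H_k\,\tilde\varphi_1^{k_1}\cdots\tilde\varphi_r^{k_r}$ is $1$-summable in the directions of $\mathcal A$, and for all sufficiently large $\tau'\ge\tau$ the following holds on $\Sigma^{\mathcal A}_{\tau'}$: the Borel sums of the $\tilde\varphi_j$ and of $\tilde H(\tilde\varphi_1,\dots,\tilde\varphi_r)$ are well defined, $|(\operatorname{Sum}^{\mathcal A}\tilde\varphi_j)(z)|<1/B$ for every $j$, and $$\operatorname{Sum}^{\mathcal A}\big(\tilde H(\tilde\varphi_1,\dots,\tilde\varphi_r)\big)(z)=\mathcal H^{\mathcal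 A}\big(z,(\operatorname{Sum}^{\mathcal A}\tilde\varphi_1)(z),\dots,(\operatorname{Sum}^{\mathcal A}\tilde\varphi_r)(z)\big).$$ 3. If moreover $N=\|\tilde\varphi_1\|_{\rho,\tau}+\cdots+\|\tilde\varphi_r\|_{\rho,\tau}$ is finite, then all the assertions of part 2 about $\Sigma^{\mathcal A}_{\tau'}$ hold with $\tau'=\tau+BN$, and for this $\tau'$ $$\|\tilde H(\tilde\varphi_1,\dots,\tilde\varphi_r)\|_{\rho,\tau'}\le A\,(2+BN).$$ -/

import Mathlib

open scoped ENNReal PowerSeries Topology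

noncomputable section

namespace OneSummable

/-- `S(ρ, A)`: the disc of radius `ρ` together with the rays whose direction lies in `A`. -/
def sector (ρ : ℝ) (A : Set ℝ) : Set ℂ :=
  Metric.ball 0 ρ ∪
    {ζ | ∃ r : ℝ, 0 < r ∧ ∃ θ ∈ A, ζ = (r : ℂ) * Complex.exp ((θ : ℂ) * Complex.I)}

/-- Formal series in `z⁻¹` are elements of `ℂ⟦X⟧` with `X = z⁻¹`. The formal Borel transform sends
`z^(-n-1)` to `ζ^n / n!` (and drops the constant term). The predicate says that `f` is holomorphic
on `S(ρ, A)` and that its germ at `0` is the (convergent) Borel transform of `φ`. -/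
def IsBorelExtension (A : Set ℝ) (ρ : ℝ) (φ : ℂ⟦X⟧) (f : ℂ → ℂ) : Prop :=
  DifferentiableOn ℂ f (sector ρ A) ∧
    ∀ᶠ ζ in 𝓝 (0 : ℂ),
      HasSum (fun n : ℕ => PowerSeries.coeff (n + 1) φ / (n.factorial : ℂ) * ζ ^ n) (f ζ)

/-- `1`-summability in the directions of `A`. -/
def IsOneSummable (A : Set ℝ) (φ : ℂ⟦X⟧) : Prop :=
  ∃ ρ : ℝ, 0 < ρ ∧ ∃ f : ℂ → ℂ, IsBorelExtension A ρ φ f ∧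
    ∃ τ C : ℝ, 0 < C ∧ ∀ ζ ∈ sector ρ A, ‖f ζ‖ ≤ C * Real.exp (τ * ‖ζ‖)

/-- The norm `‖φ‖_{ρ,τ} = |c| + sup_{S(ρ,A)} e^{-τ|ζ|} |φ̂(ζ)|`, with values in `[0, ∞]`. The
extension of the Borel transform to `S(ρ, A)` is unique when it exists, so that the infimum is over
a single value; it is `∞` when there is no extension. -/
def borelNorm (A : Set ℝ) (ρ τ : ℝ) (φ : ℂ⟦X⟧) : ℝ≥0∞ :=
  ⨅ (f : ℂ → ℂ) (_ : IsBorelExtension A ρ φ f),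
    ENNReal.ofReal ‖PowerSeries.constantCoeff φ‖ +
      ⨆ ζ ∈ sector ρ A, ENNReal.ofReal (Real.exp (-τ * ‖ζ‖) * ‖f ζ‖)

open Classical in
/-- The analytic continuation of the Borel transform along the rays with direction in `A`. -/
def borelTransform (A : Set ℝ) (φ : ℂ⟦X⟧) : ℂ → ℂ :=
  if h : ∃ f : ℂ → ℂ, ∃ ρ : ℝ, 0 < ρ ∧ IsBorelExtension A ρ φ f then Classical.choose h else 0

/-- The integrand, in the parameter `r > 0`, of the Laplace integral of the Borel transform of `φ`
along the ray `ζ = r e^{iθ}`. -/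
def laplaceIntegrand (A : Set ℝ) (φ : ℂ⟦X⟧) (θ : ℝ) (z : ℂ) (r : ℝ) : ℂ :=
  borelTransform A φ ((r : ℂ) * Complex.exp ((θ : ℂ) * Complex.I)) *
    Complex.exp (-z * ((r : ℂ) * Complex.exp ((θ : ℂ) * Complex.I))) *
    Complex.exp ((θ : ℂ) * Complex.I)

/-- Constant term plus Laplace transform of the Borel transform in the direction `θ`. -/
def laplaceSum (A : Set ℝ) (φ : ℂ⟦X⟧) (θ : ℝ) (z : ℂ) : ℂ :=
  PowerSeries.constantCoeff φ + ∫ r in Set.Ioi (0 : ℝ), laplaceIntegrand A φ θ z r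

/-- The half-plane `Re (z e^{iθ}) > τ`. -/
def halfPlane (τ θ : ℝ) : Set ℂ :=
  {z | τ < (z * Complex.exp ((θ : ℂ) * Complex.I)).re}

/-- How the half-plane of direction `θ` is placed in the union of half-planes. If `τ < 0`, the union
is taken in `ℂ`, and the second coordinate is the dummy value `0`. If `τ ≥ 0`, it is taken in the
Riemann surface of the logarithm, whose points are the pairs `(z, t)` with `z ≠ 0` and `t` a
determination of the argument of `z`; the half-plane of direction `θ` consists of its points with
`-θ - π/2 < t < -θ + π/2` (if `A` has length at most `π`, the result is the same as
the union in `ℂ`). -/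
def chart (τ θ : ℝ) (z : ℂ) : ℂ × ℝ :=
  (z, if τ < 0 then 0 else (z * Complex.exp ((θ : ℂ) * Complex.I)).arg - θ)

/-- `Σ^A_τ`: the union of the half-planes `Re (z e^{iθ}) > τ`, `θ ∈ A`. -/
def sumDomain (A : Set ℝ) (τ : ℝ) : Set (ℂ × ℝ) :=
  ⋃ θ ∈ A, chart τ θ '' halfPlane τ θ

/-- The natural map from `Σ^A_τ'` to `Σ^A_τ` for `τ ≤ τ'`: an inclusion, except that it forgets the
determination of the argument if `Σ^A_τ` is a subset of `ℂ`. -/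
def toLevel (τ : ℝ) (q : ℂ × ℝ) : ℂ × ℝ :=
  if τ < 0 then (q.1, 0) else q

/-- The natural map is the identity of half-planes in the charts. -/
theorem toLevel_chart {τ τ' : ℝ} (h : τ ≤ τ') (θ : ℝ) (z : ℂ) :
    toLevel τ (chart τ' θ z) = chart τ θ z := by
  unfold toLevel chart
  by_cases h1 : τ < 0
  · simp [h1]
  · have h2 : ¬ τ' < 0 := fun h2 => h1 (lt_of_le_of_lt h h2)
    simp [h1, h2]

open Classical in
/-- The Borel sum of `φ` as a function on `Σ^A_τ`: at a point of this surface it is the Laplace sum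
in a direction `θ ∈ A` whose half-plane contains the point. -/
def borelSum (A : Set ℝ) (τ : ℝ) (φ : ℂ⟦X⟧) (q : ℂ × ℝ) : ℂ :=
  if h : ∃ θ ∈ A, q.1 ∈ halfPlane τ θ ∧ chart τ θ q.1 = q then
    laplaceSum A φ (Classical.choose h) q.1
  else 0

/-- The Borel sum is well defined on `Σ^A_τ`: all the Laplace integrals converge, and the Laplace
sums in the various directions of `A` match, so that any `θ` gives the value of the Borel sum. -/
def BorelSumWellDefined (A : Set ℝ) (τ : ℝ) (φ : ℂ⟦X⟧) : Prop :=
  ∀ θ ∈ A, ∀ z ∈ halfPlane τ θ,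
    MeasureTheory.IntegrableOn (laplaceIntegrand A φ θ z) (Set.Ioi 0) ∧
      borelSum A τ φ (chart τ θ z) = laplaceSum A φ θ z

/-- The polydisc of radius `R` centred at `0`. -/
def polydisc (r : ℕ) (R : ℝ) : Set (Fin r → ℂ) := {w | ∀ j, ‖w j‖ < R}

/-- Holomorphy on `Σ^A_τ × U`: holomorphy, for each `θ ∈ A`, on the product of `U` and of the
half-plane of direction `θ` (these half-planes form a holomorphic atlas of `Σ^A_τ`). -/
def HolomorphicOnSumDomainProd (A : Set ℝ) (τ : ℝ) {r : ℕ} (U : Set (Fin r → ℂ))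
    (F : ℂ × ℝ → (Fin r → ℂ) → ℂ) : Prop :=
  ∀ θ ∈ A, DifferentiableOn ℂ (fun p : ℂ × (Fin r → ℂ) => F (chart τ θ p.1) p.2)
    (halfPlane τ θ ×ˢ U)

/-- The term of index `k` of the Borel-summed series. -/
def borelSumTerm (A : Set ℝ) (τ : ℝ) {r : ℕ} (H : MvPowerSeries (Fin r) ℂ⟦X⟧) (q : ℂ × ℝ)
    (w : Fin r → ℂ) (k : Fin r →₀ ℕ) : ℂ :=
  borelSum A τ (MvPowerSeries.coeff k H) q * ∏ j, w j ^ k j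

/-- The Borel-summed series `ℋ^A(z, w) = ∑_k (Sum^A H_k)(z) w^k`, for `z` in `Σ^A_τ`. -/
def borelSumSeries (A : Set ℝ) (τ : ℝ) {r : ℕ} (H : MvPowerSeries (Fin r) ℂ⟦X⟧) (q : ℂ × ℝ)
    (w : Fin r → ℂ) : ℂ :=
  ∑' k : Fin r →₀ ℕ, borelSumTerm A τ H q w k

/-- The formal series `H(φ₁, …, φ_r) = ∑_k H_k φ₁^{k₁} ⋯ φ_r^{k_r}`. If the `φ_j` have no constant
term, only finitely many `k` contribute to each coefficient. -/
def formalSubst {r : ℕ} (H : MvPowerSeries (Fin r) ℂ⟦X⟧) (φ : Fin r → ℂ⟦X⟧) : ℂ⟦X⟧ :=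
  PowerSeries.mk fun n => ∑ᶠ k : Fin r →₀ ℕ,
    PowerSeries.coeff n (MvPowerSeries.coeff k H * ∏ j, φ j ^ k j)

/-- On `Σ^A_τ'` (where `τ' ≥ τ`) the Borel sums of the `φ_j` and of `H(φ₁, …, φ_r)` are defined, the
former take their values in the discs of radius `1/b`, and
`Sum^A (H(φ₁, …, φ_r)) (z) = ℋ^A(z, (Sum^A φ₁)(z), …, (Sum^A φ_r)(z))`. -/
def BorelSumCommutesWithSubst (A : Set ℝ) (b τ τ' : ℝ) {r : ℕ}
    (H : MvPowerSeries (Fin r) ℂ⟦X⟧) (φ : Fin r → ℂ⟦X⟧) : Prop :=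
  τ ≤ τ' ∧ (∀ j, BorelSumWellDefined A τ' (φ j)) ∧ BorelSumWellDefined A τ' (formalSubst H φ) ∧
    ∀ q ∈ sumDomain A τ',
      (fun j => borelSum A τ' (φ j) q) ∈ polydisc r (1 / b) ∧
      borelSum A τ' (formalSubst H φ) q =
        borelSumSeries A τ H (toLevel τ q) (fun j => borelSum A τ' (φ j) q)

end OneSummable

end

/-!
The theorem is proved in the Borel plane, where a product of series without constant term becomes
the convolution `∫₀^ζ f(ζ - σ) g(σ) dσ` along segments of the star-shaped set `S(ρ, A)`.

* *Well-defined Borel sums.* A bound `|f(ζ)| ≤ β e^{τ|ζ|}` makes the Laplace integrals converge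
  and holomorphic on the half-planes. The path can be rotated through directions whose half-planes
  all contain `z`, by Cauchy's theorem for a rectangle in the variable `log ζ`
  (`IsBoundedExtension.laplaceSum_eq_of_forall_mem_Icc`). For `τ ≥ 0` this applies to any two
  directions with a common point on the Riemann surface of the logarithm. For `τ < 0` it applies to
  `|z| < -τ`, a disc that lies in all the half-planes, and the identity theorem does the rest.

* *Products.* The derivative of a convolution is `(f * g)' = f(0) g + f' * g`; hence `f * g` is
  holomorphic on `S(ρ, A)`, and its Taylor coefficients are those of the product series
  (`IsBorelExtension.mul`). Since the Laplace integral over a ray turns convolution into a product,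
  the Borel sum is multiplicative (`IsBorelExtension.laplaceSum_mul`).

* *Substitution.* Convolution with a function bounded by `N e^{τ|ζ|}` integrates a bound once and
  multiplies it by `N`. So if `‖H_k‖ ≤ a b^|k|`, `‖φ_j‖ ≤ N_j` and `n = |k|`, then the Borel
  transform of `H_k φ^k` is at most
  `a b^n N₁^{k₁} ⋯ N_r^{k_r} (x^(n-1)/(n-1)! + x^n/n!) e^{τx}` at `|ζ| = x`, where the first
  fraction is absent for `n = 0`
  (`exists_isBorelExtension_mul_prod_pow`). The multinomial theorem bounds the sum over `k` by
  `a (1 + bN) e^{(τ + bN)x}` with `N = N₁ + ⋯ + N_r` (`sum_termMajorant_le`). This gives the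
  norm of `H(φ₁, …, φ_r)` at the level `τ + bN`, and dominated convergence gives its Borel sum.
  When the norms of the `φ_j` are infinite for the given `ρ` and `τ`, they are finite for a smaller
  `ρ` and a larger `τ`.

* *Holomorphy of the series.* The Borel sums of the `H_k` are `O(a b^|k|)` locally uniformly, so the
  series converges locally uniformly, and Cauchy's estimate on complex lines yields the Weierstrass
  theorem in several variables (`differentiableOn_tsum_of_summable_norm_of_isOpen`).
-/

open scoped ENNReal PowerSeries Topology Interval

noncomputable section

namespace OneSummable

open Set Filter MeasureTheory

/-! ### Sectors, extensions of the Borel transform and the norm -/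

section

theorem ray_mem_sector {ρ : ℝ} {A : Set ℝ} {θ r : ℝ} (hθ : θ ∈ A) (hr : 0 < r) :
    (r : ℂ) * Complex.exp ((θ : ℂ) * Complex.I) ∈ sector ρ A :=
  Or.inr ⟨r, hr, θ, hθ, rfl⟩

theorem zero_mem_sector {ρ : ℝ} (hρ : 0 < ρ) (A : Set ℝ) : (0 : ℂ) ∈ sector ρ A :=
  Or.inl (Metric.mem_ball_self hρ)

theorem sector_mono {ρ₁ ρ₂ : ℝ} (h : ρ₁ ≤ ρ₂) (A : Set ℝ) : sector ρ₁ A ⊆ sector ρ₂ A :=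
  union_subset_union_left _ (Metric.ball_subset_ball h)

theorem norm_ray {r : ℝ} (hr : 0 ≤ r) (θ : ℝ) :
    ‖(r : ℂ) * Complex.exp ((θ : ℂ) * Complex.I)‖ = r := by
  simp [Complex.norm_exp_ofReal_mul_I, abs_of_nonneg hr]

theorem exp_eq_ray (s : ℂ) :
    Complex.exp s = ((Real.exp s.re : ℝ) : ℂ) * Complex.exp ((s.im : ℂ) * Complex.I) := by
  rw [Complex.ofReal_exp, ← Complex.exp_add, Complex.re_add_im]

theorem isOpen_sector (ρ : ℝ) {A : Set ℝ} (hA : IsOpen A) : IsOpen (sector ρ A) := by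
  have h : {ζ : ℂ | ∃ r : ℝ, 0 < r ∧ ∃ θ ∈ A, ζ = (r : ℂ) * Complex.exp ((θ : ℂ) * Complex.I)} =
      Complex.exp '' (Complex.im ⁻¹' A) := by
    ext ζ
    constructor
    · rintro ⟨r, hr, θ, hθ, rfl⟩
      refine ⟨Real.log r + θ * Complex.I, by simpa using hθ, ?_⟩
      rw [Complex.exp_add, ← Complex.ofReal_exp, Real.exp_log hr]
    · rintro ⟨s, hs, rfl⟩
      exact ⟨Real.exp s.re, Real.exp_pos _, s.im, hs, exp_eq_ray s⟩
  unfold sector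
  rw [h]
  exact Metric.isOpen_ball.union
    (Complex.isOpenMap_exp _ (hA.preimage Complex.continuous_im))

theorem smul_mem_sector {ρ : ℝ} (hρ : 0 < ρ) {A : Set ℝ} {ζ : ℂ} (hζ : ζ ∈ sector ρ A) {t : ℝ}
    (ht0 : 0 ≤ t) (ht1 : t ≤ 1) : (t : ℂ) * ζ ∈ sector ρ A := by
  rcases hζ with hζ | ⟨r, hr, θ, hθ, rfl⟩
  · refine Or.inl ?_
    rw [mem_ball_zero_iff] at hζ ⊢
    rw [norm_mul, Complex.norm_real, Real.norm_of_nonneg ht0]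
    exact lt_of_le_of_lt (mul_le_of_le_one_left (norm_nonneg _) ht1) hζ
  · rcases ht0.eq_or_lt with rfl | ht
    · simpa using zero_mem_sector hρ A
    · rw [← mul_assoc, ← Complex.ofReal_mul]
      exact ray_mem_sector hθ (mul_pos ht hr)

theorem isPreconnected_sector {ρ : ℝ} (hρ : 0 < ρ) (A : Set ℝ) :
    IsPreconnected (sector ρ A) := by
  have h : StarConvex ℝ (0 : ℂ) (sector ρ A) := by
    rw [starConvex_zero_iff]
    intro ζ hζ t ht0 ht1
    rw [Complex.real_smul]
    exact smul_mem_sector hρ hζ ht0 ht1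
  exact (h.isPathConnected (zero_mem_sector hρ A)).isConnected.isPreconnected

section Germ

/-- For a function that is holomorphic near `0`, having a given formal Borel transform as its germ
is a condition on its derivatives at `0`. -/
theorem eventually_hasSum_iff_iteratedDeriv {f : ℂ → ℂ} {U : Set ℂ} (hU : U ∈ 𝓝 (0 : ℂ))
    (hf : DifferentiableOn ℂ f U) (φ : ℂ⟦X⟧) :
    (∀ᶠ ζ in 𝓝 (0 : ℂ),
      HasSum (fun n : ℕ => PowerSeries.coeff (n + 1) φ / (n.factorial : ℂ) * ζ ^ n) (f ζ)) ↔
    ∀ n, iteratedDeriv n f 0 = PowerSeries.coeff (n + 1) φ := by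
  obtain ⟨ε, hε, hεU⟩ := Metric.mem_nhds_iff.1 hU
  have hfac : ∀ n : ℕ, (n.factorial : ℂ) ≠ 0 := fun n => by
    exact_mod_cast n.factorial_ne_zero
  constructor
  · intro h n
    obtain ⟨δ, hδ, hδU⟩ := Metric.eventually_nhds_iff_ball.1 h
    have hps : HasFPowerSeriesAt f (FormalMultilinearSeries.ofScalars ℂ
        (fun n : ℕ => PowerSeries.coeff (n + 1) φ / (n.factorial : ℂ))) 0 := by
      rw [hasFPowerSeriesAt_iff]
      filter_upwards [h] with ζ hζ
      simpa [FormalMultilinearSeries.coeff_ofScalars, mul_comm] using hζ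
    have h1 := hps.eq_formalMultilinearSeries
      (((hf.analyticAt hU)).hasFPowerSeriesAt)
    have h2 := congrArg (fun p => FormalMultilinearSeries.coeff p n) h1
    simp only [FormalMultilinearSeries.coeff_ofScalars] at h2
    field_simp [hfac n] at h2
    rw [h2]
  · intro h
    filter_upwards [Metric.ball_mem_nhds (0 : ℂ) hε] with ζ hζ
    have := Complex.hasSum_taylorSeries_on_ball (hf.mono hεU) hζ
    refine this.congr_fun fun n => ?_
    rw [h, sub_zero, smul_eq_mul, smul_eq_mul, div_eq_mul_inv]
    ring

end Germ

variable {A : Set ℝ} {ρ : ℝ} {φ : ℂ⟦X⟧} {f g : ℂ → ℂ}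

theorem sector_mem_nhds_zero (hρ : 0 < ρ) (A : Set ℝ) : sector ρ A ∈ 𝓝 (0 : ℂ) :=
  mem_of_superset (Metric.ball_mem_nhds _ hρ) subset_union_left

theorem isBorelExtension_iff (hρ : 0 < ρ) : IsBorelExtension A ρ φ f ↔
    DifferentiableOn ℂ f (sector ρ A) ∧
      ∀ n, iteratedDeriv n f 0 = PowerSeries.coeff (n + 1) φ := by
  unfold IsBorelExtension
  refine and_congr_right fun h => ?_
  exact eventually_hasSum_iff_iteratedDeriv (sector_mem_nhds_zero hρ A) h φ

theorem IsBorelExtension.mono {ρ' : ℝ} (h : IsBorelExtension A ρ φ f) (hρ : ρ' ≤ ρ) :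
    IsBorelExtension A ρ' φ f :=
  ⟨h.1.mono (sector_mono hρ A), h.2⟩

/-- Uniqueness of the extension of the Borel transform. -/
theorem IsBorelExtension.eqOn (hA : IsOpen A) (hρ : 0 < ρ) (hf : IsBorelExtension A ρ φ f)
    (hg : IsBorelExtension A ρ φ g) : EqOn f g (sector ρ A) := by
  refine AnalyticOnNhd.eqOn_of_preconnected_of_eventuallyEq
    (hf.1.analyticOnNhd (isOpen_sector ρ hA)) (hg.1.analyticOnNhd (isOpen_sector ρ hA))
    (isPreconnected_sector hρ A) (zero_mem_sector hρ A) ?_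
  filter_upwards [hf.2, hg.2] with ζ h1 h2 using h1.unique h2

theorem IsBorelExtension.borelTransform_ray (hA : IsOpen A) (hρ : 0 < ρ)
    (hf : IsBorelExtension A ρ φ f) {θ r : ℝ} (hθ : θ ∈ A) (hr : 0 < r) :
    borelTransform A φ ((r : ℂ) * Complex.exp ((θ : ℂ) * Complex.I)) =
      f ((r : ℂ) * Complex.exp ((θ : ℂ) * Complex.I)) := by
  have h : ∃ f : ℂ → ℂ, ∃ ρ : ℝ, 0 < ρ ∧ IsBorelExtension A ρ φ f := ⟨f, ρ, hρ, hf⟩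
  unfold borelTransform
  rw [dif_pos h]
  obtain ⟨ρ', hρ', h'⟩ := Classical.choose_spec h
  exact (h'.mono (min_le_left ρ' ρ)).eqOn hA (lt_min hρ' hρ) (hf.mono (min_le_right ρ' ρ))
    (ray_mem_sector hθ hr)

/-- The function `f` extends the Borel transform of `φ` to `S(ρ, A)`, with `|f(ζ)| ≤ β e^{τ|ζ|}`
there. -/
structure IsBoundedExtension (A : Set ℝ) (ρ τ : ℝ) (φ : ℂ⟦X⟧) (f : ℂ → ℂ) (β : ℝ) : Prop where
  ext : IsBorelExtension A ρ φ f
  bound : ∀ ζ ∈ sector ρ A, ‖f ζ‖ ≤ β * Real.exp (τ * ‖ζ‖)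

theorem IsBoundedExtension.mono {τ τ' ρ' β : ℝ} (h : IsBoundedExtension A ρ τ φ f β) (hβ : 0 ≤ β)
    (hρ : ρ' ≤ ρ) (hτ : τ ≤ τ') : IsBoundedExtension A ρ' τ' φ f β where
  ext := h.ext.mono hρ
  bound ζ hζ := (h.bound ζ (sector_mono hρ A hζ)).trans <|
    mul_le_mul_of_nonneg_left
      (Real.exp_le_exp.2 (mul_le_mul_of_nonneg_right hτ (norm_nonneg _))) hβ

theorem IsBoundedExtension.mono_bound {τ β β' : ℝ} (h : IsBoundedExtension A ρ τ φ f β)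
    (hβ : β ≤ β') : IsBoundedExtension A ρ τ φ f β' where
  ext := h.ext
  bound ζ hζ := (h.bound ζ hζ).trans (mul_le_mul_of_nonneg_right hβ (Real.exp_pos _).le)

theorem exp_neg_mul_mul_le_iff {τ x y β : ℝ} :
    Real.exp (-τ * x) * y ≤ β ↔ y ≤ β * Real.exp (τ * x) := by
  rw [neg_mul, Real.exp_neg, inv_mul_le_iff₀ (Real.exp_pos _), mul_comm]

/-- A bound for the norm yields a bounded extension: the infimum over all extensions runs over a
single value. -/
theorem exists_isBoundedExtension (hA : IsOpen A) (hρ : 0 < ρ) {τ M : ℝ} (hM : 0 ≤ M)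
    (h : borelNorm A ρ τ φ ≤ ENNReal.ofReal M) :
    ∃ f β, IsBoundedExtension A ρ τ φ f β ∧ 0 ≤ β ∧ ‖PowerSeries.constantCoeff φ‖ + β ≤ M := by
  obtain ⟨f, hf⟩ : ∃ f, IsBorelExtension A ρ φ f := by
    by_contra hne
    push Not at hne
    have : borelNorm A ρ τ φ = ⊤ := by
      unfold borelNorm
      simp [hne]
    rw [this] at h
    exact ENNReal.ofReal_ne_top (top_le_iff.1 h)
  have hle : ENNReal.ofReal ‖PowerSeries.constantCoeff φ‖ +
      ⨆ ζ ∈ sector ρ A, ENNReal.ofReal (Real.exp (-τ * ‖ζ‖) * ‖f ζ‖) ≤ borelNorm A ρ τ φ := by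
    refine le_iInf₂ fun g hg => ?_
    gcongr ENNReal.ofReal _ + ?_
    refine iSup₂_mono fun ζ hζ => ?_
    rw [hf.eqOn hA hρ hg hζ]
  have key : ∀ ζ ∈ sector ρ A,
      ‖PowerSeries.constantCoeff φ‖ + Real.exp (-τ * ‖ζ‖) * ‖f ζ‖ ≤ M := by
    intro ζ hζ
    rw [← ENNReal.ofReal_le_ofReal_iff hM, ENNReal.ofReal_add (norm_nonneg _) (by positivity)]
    refine le_trans ?_ (hle.trans h)
    gcongr
    exact le_iSup₂ (f := fun ζ (_ : ζ ∈ sector ρ A) =>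
      ENNReal.ofReal (Real.exp (-τ * ‖ζ‖) * ‖f ζ‖)) ζ hζ
  refine ⟨f, M - ‖PowerSeries.constantCoeff φ‖, ⟨hf, fun ζ hζ => ?_⟩, ?_, by linarith⟩
  · rw [← exp_neg_mul_mul_le_iff]
    linarith [key ζ hζ]
  · have := key 0 (zero_mem_sector hρ A)
    have h2 : 0 ≤ Real.exp (-τ * ‖(0 : ℂ)‖) * ‖f 0‖ := by positivity
    linarith

theorem IsBoundedExtension.borelNorm_le {τ β : ℝ} (hβ : 0 ≤ β)
    (h : IsBoundedExtension A ρ τ φ f β) :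
    borelNorm A ρ τ φ ≤ ENNReal.ofReal (‖PowerSeries.constantCoeff φ‖ + β) := by
  refine (iInf₂_le f h.ext).trans ?_
  rw [ENNReal.ofReal_add (norm_nonneg _) hβ]
  gcongr
  exact iSup₂_le fun ζ hζ => ENNReal.ofReal_le_ofReal (exp_neg_mul_mul_le_iff.2 (h.bound ζ hζ))

end

/-! ### Convolution in the Borel plane -/

section

theorem hasDerivAt_intervalIntegral_of_continuousOn {U : Set ℂ} (hU : IsOpen U)
    {F F' : ℂ → ℝ → ℂ} (hF : ∀ ζ ∈ U, ∀ t ∈ Icc (0 : ℝ) 1, HasDerivAt (F · t) (F' ζ t) ζ)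
    (hFc : ContinuousOn (Function.uncurry F) (U ×ˢ Icc (0 : ℝ) 1))
    (hFc' : ContinuousOn (Function.uncurry F') (U ×ˢ Icc (0 : ℝ) 1)) {ζ : ℂ} (hζ : ζ ∈ U) :
    HasDerivAt (fun ζ => ∫ t in (0 : ℝ)..1, F ζ t) (∫ t in (0 : ℝ)..1, F' ζ t) ζ := by
  have hslice : ∀ {G : ℂ → ℝ → ℂ}, ContinuousOn (Function.uncurry G) (U ×ˢ Icc (0 : ℝ) 1) →
      ∀ x ∈ U, IntervalIntegrable (G x) volume 0 1 := by
    intro G hG x hx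
    have : ContinuousOn (G x) (Icc 0 1) :=
      hG.comp (f := fun t : ℝ => (x, t)) (by fun_prop) fun t ht => ⟨hx, ht⟩
    exact this.intervalIntegrable_of_Icc zero_le_one
  obtain ⟨ε, hε, hεU⟩ := Metric.nhds_basis_closedBall.mem_iff.1 (hU.mem_nhds hζ)
  obtain ⟨C, hC⟩ := ((isCompact_closedBall ζ ε).prod (isCompact_Icc (a := (0 : ℝ))
    (b := 1))).exists_bound_of_continuousOn (hFc'.mono (prod_mono_left hεU))
  have huIoc : Ι (0 : ℝ) 1 ⊆ Icc 0 1 := by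
    rw [uIoc_of_le zero_le_one]; exact Ioc_subset_Icc_self
  refine (intervalIntegral.hasDerivAt_integral_of_dominated_loc_of_deriv_le
    (bound := fun _ => C) (Metric.closedBall_mem_nhds ζ hε) ?_ (hslice hFc ζ hζ)
    (hslice hFc' ζ hζ).def'.aestronglyMeasurable ?_ (by simp) ?_).2
  · filter_upwards [hU.mem_nhds hζ] with x hx
    exact (hslice hFc x hx).def'.aestronglyMeasurable
  · exact ae_of_all _ fun t ht x hx => hC (x, t) ⟨hx, huIoc ht⟩
  · exact ae_of_all _ fun t ht x hx => hF x (hεU hx) t (huIoc ht)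

/-- The convolution `∫₀^ζ f(ζ - σ) g(σ) dσ` along the segment from `0` to `ζ`, the counterpart in
the Borel plane of the product of two series without constant term. -/
def segmentConv (f g : ℂ → ℂ) (ζ : ℂ) : ℂ :=
  ζ * ∫ t in (0 : ℝ)..1, f (((1 - t : ℝ) : ℂ) * ζ) * g ((t : ℂ) * ζ)

variable {U : Set ℂ} {f g : ℂ → ℂ}

theorem continuousOn_slice (h1 : ∀ ζ ∈ U, ∀ t ∈ Icc (0 : ℝ) 1, (t : ℂ) * ζ ∈ U)
    (hf : ContinuousOn f U) (hg : ContinuousOn g U) :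
    ContinuousOn (fun p : ℂ × ℝ => f (((1 - p.2 : ℝ) : ℂ) * p.1) * g ((p.2 : ℂ) * p.1))
      (U ×ˢ Icc (0 : ℝ) 1) := by
  refine ContinuousOn.mul (hf.comp (by fun_prop) ?_) (hg.comp (by fun_prop) ?_)
  · exact fun p hp => h1 _ hp.1 _ ⟨by linarith [hp.2.2], by linarith [hp.2.1]⟩
  · exact fun p hp => h1 _ hp.1 _ hp.2

/-- Differentiation of a convolution: `(f * g)' = f(0) g + f' * g`. -/
theorem hasDerivAt_segmentConv (hU : IsOpen U)
    (h1 : ∀ ζ ∈ U, ∀ t ∈ Icc (0 : ℝ) 1, (t : ℂ) * ζ ∈ U)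
    (hf : DifferentiableOn ℂ f U) (hg : DifferentiableOn ℂ g U) {ζ : ℂ} (hζ : ζ ∈ U) :
    HasDerivAt (segmentConv f g) (f 0 * g ζ + segmentConv (deriv f) g ζ) ζ := by
  have hdf : ∀ x ∈ U, HasDerivAt f (deriv f x) x := fun x hx =>
    (hf.differentiableAt (hU.mem_nhds hx)).hasDerivAt
  have hdg : ∀ x ∈ U, HasDerivAt g (deriv g x) x := fun x hx =>
    (hg.differentiableAt (hU.mem_nhds hx)).hasDerivAt
  have hcf' : ContinuousOn (deriv f) U := (hf.deriv hU).continuousOn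
  have hcg' : ContinuousOn (deriv g) U := (hg.deriv hU).continuousOn
  have h1' : ∀ ζ ∈ U, ∀ t ∈ Icc (0 : ℝ) 1, ((1 - t : ℝ) : ℂ) * ζ ∈ U := fun ζ hζ t ht =>
    h1 ζ hζ _ ⟨by linarith [ht.2], by linarith [ht.1]⟩
  have hfg := continuousOn_slice h1 hf.continuousOn hg.continuousOn
  have hf'g := continuousOn_slice h1 hcf' hg.continuousOn
  have hfg' := continuousOn_slice h1 hf.continuousOn hcg'
  have hslice : ∀ {G : ℂ × ℝ → ℂ}, ContinuousOn G (U ×ˢ Icc (0 : ℝ) 1) →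
      ContinuousOn (fun t : ℝ => G (ζ, t)) (Icc 0 1) := fun hG =>
    hG.comp (f := fun t : ℝ => (ζ, t)) (by fun_prop) fun t ht => ⟨hζ, ht⟩
  have hK := hasDerivAt_intervalIntegral_of_continuousOn hU
    (F := fun ζ t => f (((1 - t : ℝ) : ℂ) * ζ) * g ((t : ℂ) * ζ))
    (F' := fun ζ t => ((1 - t : ℝ) : ℂ) * (deriv f (((1 - t : ℝ) : ℂ) * ζ) * g ((t : ℂ) * ζ)) +
      (t : ℂ) * (f (((1 - t : ℝ) : ℂ) * ζ) * deriv g ((t : ℂ) * ζ)))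
    (fun x hx t ht => by
      have e1 := (hdf _ (h1' x hx t ht)).comp x ((hasDerivAt_id x).const_mul ((1 - t : ℝ) : ℂ))
      have e2 := (hdg _ (h1 x hx t ht)).comp x ((hasDerivAt_id x).const_mul (t : ℂ))
      refine (e1.mul e2).congr_deriv ?_
      simp only [Function.comp_apply]
      ring) hfg
    ((ContinuousOn.mul (by fun_prop) hf'g).add (ContinuousOn.mul (by fun_prop) hfg')) hζ
  refine ((hasDerivAt_id ζ).mul hK).congr_deriv ?_
  -- The difference of the two sides is the integral of a derivative in `t`.
  have hft : ∫ t in (0 : ℝ)..1, (f (((1 - t : ℝ) : ℂ) * ζ) * g ((t : ℂ) * ζ) +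
      (t : ℂ) * (f (((1 - t : ℝ) : ℂ) * ζ) * deriv g ((t : ℂ) * ζ)) * ζ -
      (t : ℂ) * (deriv f (((1 - t : ℝ) : ℂ) * ζ) * g ((t : ℂ) * ζ)) * ζ) = f 0 * g ζ := by
    rw [intervalIntegral.integral_eq_sub_of_hasDerivAt
      (f := fun t : ℝ => (t : ℂ) * (f (((1 - t : ℝ) : ℂ) * ζ) * g ((t : ℂ) * ζ)))]
    · simp
    · intro t ht
      rw [uIcc_of_le zero_le_one] at ht
      have c1 : HasDerivAt (fun t : ℝ => (t : ℂ)) 1 t := Complex.ofRealCLM.hasDerivAt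
      have c2 : HasDerivAt (fun t : ℝ => ((1 - t : ℝ) : ℂ) * ζ) (-ζ) t := by
        have : HasDerivAt (fun t : ℝ => ((1 : ℂ) - t) * ζ) (-ζ) t := by
          simpa using (c1.const_sub 1).mul_const ζ
        simpa using this
      have c3 : HasDerivAt (fun t : ℝ => (t : ℂ) * ζ) ζ t := by simpa using c1.mul_const ζ
      have e1 := (hdf _ (h1' ζ hζ t ht)).comp t c2
      have e2 := (hdg _ (h1 ζ hζ t ht)).comp t c3
      refine (c1.mul (e1.mul e2)).congr_deriv ?_
      simp only [Function.comp_apply, Pi.mul_apply]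
      ring
    · refine ContinuousOn.intervalIntegrable_of_Icc zero_le_one ?_
      refine ((hslice hfg).add ((ContinuousOn.mul (by fun_prop) (hslice hfg')).mul
        continuousOn_const)).sub ((ContinuousOn.mul (by fun_prop) (hslice hf'g)).mul
        continuousOn_const)
  have hi : ∀ {G : ℝ → ℂ}, ContinuousOn G (Icc 0 1) → IntervalIntegrable G volume 0 1 :=
    fun hG => hG.intervalIntegrable_of_Icc zero_le_one
  unfold segmentConv
  rw [← hft, ← intervalIntegral.integral_const_mul ζ, id, one_mul,
    ← intervalIntegral.integral_const_mul ζ,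
    ← intervalIntegral.integral_add, ← intervalIntegral.integral_add]
  · refine intervalIntegral.integral_congr fun t _ => ?_
    push_cast
    ring
  · exact hi (((hslice hfg).add ((ContinuousOn.mul (by fun_prop) (hslice hfg')).mul
        continuousOn_const)).sub ((ContinuousOn.mul (by fun_prop) (hslice hf'g)).mul
        continuousOn_const))
  · exact hi (continuousOn_const.mul (hslice hf'g))
  · exact hi (hslice hfg)
  · exact hi (continuousOn_const.mul ((ContinuousOn.mul (by fun_prop) (hslice hf'g)).add
      (ContinuousOn.mul (by fun_prop) (hslice hfg'))))

theorem differentiableOn_segmentConv (hU : IsOpen U)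
    (h1 : ∀ ζ ∈ U, ∀ t ∈ Icc (0 : ℝ) 1, (t : ℂ) * ζ ∈ U)
    (hf : DifferentiableOn ℂ f U) (hg : DifferentiableOn ℂ g U) :
    DifferentiableOn ℂ (segmentConv f g) U := fun _ hζ =>
  (hasDerivAt_segmentConv hU h1 hf hg hζ).differentiableAt.differentiableWithinAt

@[simp]
theorem segmentConv_zero : segmentConv f g 0 = 0 := by simp [segmentConv]

theorem contDiffAt_of_differentiableOn (hU : U ∈ 𝓝 (0 : ℂ)) (hf : DifferentiableOn ℂ f U) (n : ℕ) :
    ContDiffAt ℂ n f 0 :=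
  (hf.analyticAt hU).contDiffAt

theorem iteratedDeriv_segmentConv (hU : IsOpen U) (h0 : (0 : ℂ) ∈ U)
    (h1 : ∀ ζ ∈ U, ∀ t ∈ Icc (0 : ℝ) 1, (t : ℂ) * ζ ∈ U)
    (hg : DifferentiableOn ℂ g U) (n : ℕ) : ∀ {f : ℂ → ℂ}, DifferentiableOn ℂ f U →
    iteratedDeriv (n + 1) (segmentConv f g) 0 =
      ∑ i ∈ Finset.range (n + 1), iteratedDeriv i f 0 * iteratedDeriv (n - i) g 0 := by
  induction n with
  | zero =>
    intro f hf
    rw [zero_add, iteratedDeriv_one, (hasDerivAt_segmentConv hU h1 hf hg h0).deriv]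
    simp
  | succ n ih =>
    intro f hf
    have hev : deriv (segmentConv f g) =ᶠ[𝓝 0]
        (fun ζ => f 0 * g ζ) + segmentConv (deriv f) g := by
      filter_upwards [hU.mem_nhds h0] with ζ hζ
      exact (hasDerivAt_segmentConv hU h1 hf hg hζ).deriv
    rw [iteratedDeriv_succ', hev.iteratedDeriv_eq, iteratedDeriv_add, ih (hf.deriv hU),
      Finset.sum_range_succ' _ (n + 1), iteratedDeriv_const_mul_field]
    · simp only [iteratedDeriv_succ', iteratedDeriv_zero, Nat.sub_zero, Nat.add_sub_add_right]
      ring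
    · exact contDiffAt_of_differentiableOn (hU.mem_nhds h0) (hg.const_mul _) _
    · exact contDiffAt_of_differentiableOn (hU.mem_nhds h0)
        (differentiableOn_segmentConv hU h1 (hf.deriv hU) hg) _

/-- If `|f(ζ)|` and `|g(ζ)|` are at most `p(|ζ|)` and `b` up to a factor `e^{τ|ζ|}`, then
`|(f * g)(ζ)|` is at most `b ∫₀^{|ζ|} p` up to the same factor. -/
theorem norm_segmentConv_le {τ b : ℝ} {ζ : ℂ} {p P : ℝ → ℝ} (hp : Continuous p)
    (hP : ∀ x, HasDerivAt P (p x) x)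
    (hf : ∀ t ∈ Icc (0 : ℝ) 1, ‖f ((t : ℂ) * ζ)‖ ≤
      p ‖(t : ℂ) * ζ‖ * Real.exp (τ * ‖(t : ℂ) * ζ‖))
    (hg : ∀ t ∈ Icc (0 : ℝ) 1, ‖g ((t : ℂ) * ζ)‖ ≤ b * Real.exp (τ * ‖(t : ℂ) * ζ‖)) :
    ‖segmentConv f g ζ‖ ≤ b * (P ‖ζ‖ - P 0) * Real.exp (τ * ‖ζ‖) := by
  have hn : ∀ t ∈ Icc (0 : ℝ) 1, ‖(t : ℂ) * ζ‖ = t * ‖ζ‖ := fun t ht => by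
    rw [norm_mul, Complex.norm_real, Real.norm_of_nonneg ht.1]
  have key : ‖∫ t in (0 : ℝ)..1, f (((1 - t : ℝ) : ℂ) * ζ) * g ((t : ℂ) * ζ)‖ ≤
      ∫ t in (0 : ℝ)..1, b * Real.exp (τ * ‖ζ‖) * p ((1 - t) * ‖ζ‖) := by
    refine intervalIntegral.norm_integral_le_of_norm_le zero_le_one
      (ae_of_all _ fun t ht => ?_) (by apply Continuous.intervalIntegrable; fun_prop)
    have ht' : t ∈ Icc (0 : ℝ) 1 := ⟨ht.1.le, ht.2⟩
    have ht2 : 1 - t ∈ Icc (0 : ℝ) 1 := ⟨by linarith [ht.2], by linarith [ht.1]⟩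
    have e1 := hf _ ht2
    have e2 := hg _ ht'
    rw [hn _ ht2] at e1
    rw [hn _ ht'] at e2
    rw [norm_mul]
    refine (mul_le_mul e1 e2 (norm_nonneg _) ((norm_nonneg _).trans e1)).trans_eq ?_
    have : Real.exp (τ * ‖ζ‖) = Real.exp (τ * ((1 - t) * ‖ζ‖)) * Real.exp (τ * (t * ‖ζ‖)) := by
      rw [← Real.exp_add]; ring_nf
    rw [this]
    ring
  have hint : ‖ζ‖ * ∫ t in (0 : ℝ)..1, p ((1 - t) * ‖ζ‖) = P ‖ζ‖ - P 0 := by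
    rw [← intervalIntegral.integral_const_mul, intervalIntegral.integral_eq_sub_of_hasDerivAt
      (f := fun t : ℝ => -P ((1 - t) * ‖ζ‖))]
    · simp
      ring
    · intro t _
      have h1 : HasDerivAt (fun t : ℝ => (1 - t) * ‖ζ‖) (-‖ζ‖) t := by
        simpa using ((hasDerivAt_id t).const_sub 1).mul_const ‖ζ‖
      exact ((hP _).comp t h1).neg.congr_deriv (by ring)
    · apply Continuous.intervalIntegrable
      fun_prop
  rw [intervalIntegral.integral_const_mul] at key
  unfold segmentConv
  rw [norm_mul, ← hint]
  refine (mul_le_mul_of_nonneg_left key (norm_nonneg _)).trans_eq ?_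
  ring

variable {A : Set ℝ} {ρ : ℝ} {φ ψ : ℂ⟦X⟧}

/-- The Borel transform of a product of series is given by convolution, with extra terms that come
from the constant terms. -/
theorem IsBorelExtension.mul (hA : IsOpen A) (hρ : 0 < ρ) (hf : IsBorelExtension A ρ φ f)
    (hg : IsBorelExtension A ρ ψ g) :
    IsBorelExtension A ρ (φ * ψ) (fun ζ => PowerSeries.constantCoeff φ * g ζ +
      PowerSeries.constantCoeff ψ * f ζ + segmentConv f g ζ) := by
  rw [isBorelExtension_iff hρ] at hf hg ⊢
  have hU := isOpen_sector ρ hA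
  have h0 := zero_mem_sector hρ A
  have h1 : ∀ ζ ∈ sector ρ A, ∀ t ∈ Icc (0 : ℝ) 1, (t : ℂ) * ζ ∈ sector ρ A :=
    fun ζ hζ t ht => smul_mem_sector hρ hζ ht.1 ht.2
  have hconv := differentiableOn_segmentConv hU h1 hf.1 hg.1
  refine ⟨((hg.1.const_mul _).add (hf.1.const_mul _)).add hconv, fun n => ?_⟩
  have hcd : ∀ {h : ℂ → ℂ}, DifferentiableOn ℂ h (sector ρ A) → ContDiffAt ℂ n h 0 :=
    fun hh => contDiffAt_of_differentiableOn (hU.mem_nhds h0) hh n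
  have hs := iteratedDeriv_fun_add (hcd ((hg.1.const_mul (PowerSeries.constantCoeff φ)).add
    (hf.1.const_mul (PowerSeries.constantCoeff ψ)))) (hcd hconv)
  have hs2 := iteratedDeriv_fun_add (hcd (hg.1.const_mul (PowerSeries.constantCoeff φ)))
    (hcd (hf.1.const_mul (PowerSeries.constantCoeff ψ)))
  refine hs.trans ?_
  refine (congrArg (· + iteratedDeriv n (segmentConv f g) 0) hs2).trans ?_
  simp only [iteratedDeriv_const_mul_field, hf.2, hg.2]
  rw [PowerSeries.coeff_mul, Finset.Nat.sum_antidiagonal_eq_sum_range_succ_mk,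
    Finset.sum_range_succ', Finset.sum_range_succ]
  cases n with
  | zero => simp; ring
  | succ n =>
    rw [iteratedDeriv_segmentConv hU h0 h1 hg.1 n hf.1]
    simp only [hf.2, hg.2]
    have : ∀ i ∈ Finset.range (n + 1), PowerSeries.coeff (i + 1) φ *
        PowerSeries.coeff (n - i + 1) ψ = PowerSeries.coeff (i + 1) φ *
        PowerSeries.coeff (n + 1 + 1 - (i + 1)) ψ := by
      intro i hi
      rw [Finset.mem_range] at hi
      congr 3
      omega
    rw [Finset.sum_congr rfl this]
    simp
    ring

end

/-! ### Laplace integrals and well-defined Borel sums -/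

section

variable {A : Set ℝ} {ρ τ β θ : ℝ} {φ : ℂ⟦X⟧} {f : ℂ → ℂ} {z : ℂ}

theorem isOpen_halfPlane (τ θ : ℝ) : IsOpen (halfPlane τ θ) :=
  isOpen_lt continuous_const (by fun_prop)

theorem convex_halfPlane (τ θ : ℝ) : Convex ℝ (halfPlane τ θ) := by
  have h : halfPlane τ θ = (fun z : ℂ => (z * Complex.exp ((θ : ℂ) * Complex.I)).re) ⁻¹' Ioi τ :=
    rfl
  rw [h]
  exact (convex_Ioi τ).is_linear_preimage
    ⟨fun x y => by rw [add_mul, Complex.add_re], fun c x => by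
      rw [smul_mul_assoc, Complex.smul_re]⟩

theorem halfPlane_anti {τ τ' : ℝ} (h : τ ≤ τ') (θ : ℝ) : halfPlane τ' θ ⊆ halfPlane τ θ :=
  fun _ hz => lt_of_le_of_lt h hz

theorem norm_laplaceIntegrand (A : Set ℝ) (φ : ℂ⟦X⟧) (θ : ℝ) (z : ℂ) (r : ℝ) :
    ‖laplaceIntegrand A φ θ z r‖ =
      ‖borelTransform A φ ((r : ℂ) * Complex.exp ((θ : ℂ) * Complex.I))‖ *
        Real.exp (-(r * (z * Complex.exp ((θ : ℂ) * Complex.I)).re)) := by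
  unfold laplaceIntegrand
  rw [norm_mul, norm_mul, Complex.norm_exp_ofReal_mul_I, mul_one, Complex.norm_exp]
  congr 2
  rw [show -z * ((r : ℂ) * Complex.exp ((θ : ℂ) * Complex.I)) =
    -((r : ℂ) * (z * Complex.exp ((θ : ℂ) * Complex.I))) by ring, Complex.neg_re,
    Complex.re_ofReal_mul]

theorem IsBorelExtension.continuousOn_laplaceIntegrand (hA : IsOpen A) (hρ : 0 < ρ)
    (hf : IsBorelExtension A ρ φ f) (hθ : θ ∈ A) (z : ℂ) :
    ContinuousOn (laplaceIntegrand A φ θ z) (Ioi 0) := by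
  have h : ContinuousOn (fun r : ℝ => f ((r : ℂ) * Complex.exp ((θ : ℂ) * Complex.I)) *
    Complex.exp (-z * ((r : ℂ) * Complex.exp ((θ : ℂ) * Complex.I))) *
    Complex.exp ((θ : ℂ) * Complex.I)) (Ioi 0) := by
    refine ContinuousOn.mul (ContinuousOn.mul ?_ (by fun_prop)) continuousOn_const
    exact hf.1.continuousOn.comp (by fun_prop) fun r hr => ray_mem_sector hθ hr
  refine h.congr fun r hr => ?_
  unfold laplaceIntegrand
  rw [hf.borelTransform_ray hA hρ hθ hr]

theorem IsBorelExtension.aestronglyMeasurable_laplaceIntegrand (hA : IsOpen A) (hρ : 0 < ρ)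
    (hf : IsBorelExtension A ρ φ f) (hθ : θ ∈ A) (z : ℂ) :
    AEStronglyMeasurable (laplaceIntegrand A φ θ z) (volume.restrict (Ioi 0)) :=
  (hf.continuousOn_laplaceIntegrand hA hρ hθ z).aestronglyMeasurable measurableSet_Ioi

theorem IsBoundedExtension.norm_laplaceIntegrand_le (hA : IsOpen A) (hρ : 0 < ρ)
    (hf : IsBoundedExtension A ρ τ φ f β) (hθ : θ ∈ A) (z : ℂ) {r : ℝ} (hr : 0 < r) :
    ‖laplaceIntegrand A φ θ z r‖ ≤
      β * Real.exp ((τ - (z * Complex.exp ((θ : ℂ) * Complex.I)).re) * r) := by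
  rw [norm_laplaceIntegrand, hf.ext.borelTransform_ray hA hρ hθ hr]
  refine (mul_le_mul_of_nonneg_right (hf.bound _ (ray_mem_sector hθ hr))
    (Real.exp_pos _).le).trans_eq ?_
  rw [norm_ray hr.le, mul_assoc, ← Real.exp_add]
  ring_nf

theorem IsBoundedExtension.integrableOn_laplaceIntegrand (hA : IsOpen A) (hρ : 0 < ρ)
    (hf : IsBoundedExtension A ρ τ φ f β) (hθ : θ ∈ A) (hz : z ∈ halfPlane τ θ) :
    IntegrableOn (laplaceIntegrand A φ θ z) (Ioi 0) := by
  refine Integrable.mono' ((integrableOn_exp_mul_Ioi (sub_neg.2 hz) 0).const_mul β)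
    (hf.ext.aestronglyMeasurable_laplaceIntegrand hA hρ hθ z) ?_
  filter_upwards [ae_restrict_mem measurableSet_Ioi] with r hr
  exact hf.norm_laplaceIntegrand_le hA hρ hθ z hr

theorem IsBoundedExtension.norm_integral_laplaceIntegrand_le (hA : IsOpen A) (hρ : 0 < ρ)
    (hf : IsBoundedExtension A ρ τ φ f β) (hθ : θ ∈ A) (hz : z ∈ halfPlane τ θ) :
    ‖∫ r in Ioi (0 : ℝ), laplaceIntegrand A φ θ z r‖ ≤
      β / ((z * Complex.exp ((θ : ℂ) * Complex.I)).re - τ) := by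
  refine (norm_integral_le_of_norm_le
    ((integrableOn_exp_mul_Ioi (sub_neg.2 hz) 0).const_mul β) ?_).trans_eq ?_
  · filter_upwards [ae_restrict_mem measurableSet_Ioi] with r hr
    exact hf.norm_laplaceIntegrand_le hA hρ hθ z hr
  · rw [integral_const_mul, integral_exp_mul_Ioi (sub_neg.2 hz), mul_zero, Real.exp_zero,
      ← neg_sub (Complex.re _) τ, neg_div_neg_eq, mul_one_div]

theorem IsBoundedExtension.differentiableOn_laplaceSum (hA : IsOpen A) (hρ : 0 < ρ)
    (hf : IsBoundedExtension A ρ τ φ f β) (hβ : 0 ≤ β) (hθ : θ ∈ A) :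
    DifferentiableOn ℂ (laplaceSum A φ θ) (halfPlane τ θ) := by
  intro z hz
  refine DifferentiableAt.differentiableWithinAt ?_
  set e : ℂ := Complex.exp ((θ : ℂ) * Complex.I) with he
  obtain ⟨δ, hδ, hzδ⟩ : ∃ δ > 0, z ∈ halfPlane (τ + δ) θ := by
    have hz' : τ < (z * e).re := hz
    exact ⟨((z * e).re - τ) / 2, by linarith, show τ + ((z * e).re - τ) / 2 < (z * e).re by
      linarith⟩
  have hne : ‖e‖ = 1 := Complex.norm_exp_ofReal_mul_I θ
  have hcont := hf.ext.continuousOn_laplaceIntegrand hA hρ hθ z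
  refine DifferentiableAt.const_add _ (hasDerivAt_integral_of_dominated_loc_of_deriv_le
    (F := fun z r => laplaceIntegrand A φ θ z r)
    (F' := fun z r => laplaceIntegrand A φ θ z r * (-((r : ℂ) * e)))
    (bound := fun r => β * (2 / δ) * Real.exp (-(δ / 2) * r))
    ((isOpen_halfPlane (τ + δ) θ).mem_nhds hzδ) ?_
    (hf.integrableOn_laplaceIntegrand hA hρ hθ hz) ?_ ?_ ?_ ?_).2.differentiableAt
  · exact Eventually.of_forall fun z =>
      hf.ext.aestronglyMeasurable_laplaceIntegrand hA hρ hθ z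
  · exact (hcont.mul (by fun_prop)).aestronglyMeasurable measurableSet_Ioi
  · filter_upwards [ae_restrict_mem measurableSet_Ioi] with r hr x hx
    have hr' : (0 : ℝ) < r := hr
    have hx' : τ + δ < (x * e).re := hx
    rw [norm_mul, norm_neg, norm_mul, hne, mul_one, Complex.norm_real, Real.norm_of_nonneg hr'.le]
    have h1 := hf.norm_laplaceIntegrand_le hA hρ hθ x hr'
    have h2 : Real.exp ((τ - (x * e).re) * r) ≤ Real.exp (-δ * r) :=
      Real.exp_le_exp.2 (mul_le_mul_of_nonneg_right (by linarith) hr'.le)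
    have h3 : r ≤ 2 / δ * Real.exp (δ / 2 * r) := by
      have := Real.add_one_le_exp (δ / 2 * r)
      rw [div_mul_eq_mul_div, le_div_iff₀ hδ]
      linarith
    calc _ ≤ (β * Real.exp (-δ * r)) * (2 / δ * Real.exp (δ / 2 * r)) :=
          mul_le_mul (h1.trans (mul_le_mul_of_nonneg_left h2 hβ)) h3 hr'.le (by positivity)
      _ = β * (2 / δ) * (Real.exp (-δ * r) * Real.exp (δ / 2 * r)) := by ring
      _ = _ := by rw [← Real.exp_add]; ring_nf
  · exact (integrableOn_exp_mul_Ioi (by linarith) 0).const_mul _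
  · refine ae_of_all _ fun r x _ => ?_
    have h1 : HasDerivAt (fun x : ℂ => Complex.exp (-x * ((r : ℂ) * e)))
        (Complex.exp (-x * ((r : ℂ) * e)) * (-((r : ℂ) * e))) x := by
      have := ((hasDerivAt_id x).neg.mul_const ((r : ℂ) * e)).cexp
      simpa using this
    have h2 := (h1.const_mul (borelTransform A φ ((r : ℂ) * e))).mul_const e
    refine h2.congr_deriv ?_
    simp only [laplaceIntegrand, ← he]
    ring

/-- The Laplace integral in the logarithmic variable `s`, `ζ = e^s`; the ray of direction `θ`
corresponds to the line `Im s = θ`. -/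
theorem integral_laplaceIntegrand_comp_exp (hi : IntegrableOn (laplaceIntegrand A φ θ z) (Ioi 0)) :
    Integrable (fun x : ℝ => (Real.exp x : ℂ) * laplaceIntegrand A φ θ z (Real.exp x)) ∧
      ∫ x : ℝ, (Real.exp x : ℂ) * laplaceIntegrand A φ θ z (Real.exp x) =
        ∫ r in Ioi (0 : ℝ), laplaceIntegrand A φ θ z r := by
  have him : Real.exp '' univ = Ioi 0 := by rw [image_univ, Real.range_exp]
  have hd : ∀ x ∈ (univ : Set ℝ), HasDerivWithinAt Real.exp (Real.exp x) univ x := fun x _ =>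
    (Real.hasDerivAt_exp x).hasDerivWithinAt
  constructor
  · rw [← him, integrableOn_image_iff_integrableOn_abs_deriv_smul MeasurableSet.univ hd
      Real.exp_injective.injOn] at hi
    simpa [integrableOn_univ] using hi
  · rw [← him, integral_image_eq_integral_abs_deriv_smul MeasurableSet.univ hd
      Real.exp_injective.injOn]
    simp

/-- Rotation of the path of integration: the Laplace integral does not change when `θ` moves
through directions whose half-planes all contain `z`, at a distance from the boundary that is
bounded below. -/
theorem IsBoundedExtension.laplaceSum_eq_of_forall_mem_Icc (hA : IsOpen A) (hρ : 0 < ρ)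
    (hf : IsBoundedExtension A ρ τ φ f β) (hβ : 0 ≤ β) {θ₁ θ₂ δ : ℝ} (hθ : θ₁ ≤ θ₂) (hδ : 0 < δ)
    (hθA : Icc θ₁ θ₂ ⊆ A)
    (hz : ∀ θ ∈ Icc θ₁ θ₂, τ + δ ≤ (z * Complex.exp ((θ : ℂ) * Complex.I)).re) :
    laplaceSum A φ θ₁ z = laplaceSum A φ θ₂ z := by
  set h : ℂ → ℂ := fun s => f (Complex.exp s) * Complex.exp (-z * Complex.exp s) * Complex.exp s
    with hh
  have hexp : ∀ x y : ℝ, Complex.exp (x + y * Complex.I) =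
      (Real.exp x : ℂ) * Complex.exp ((y : ℂ) * Complex.I) := fun x y => by
    rw [Complex.exp_add, Complex.ofReal_exp]
  have hline : ∀ θ ∈ Icc θ₁ θ₂, ∀ x : ℝ, h (x + θ * Complex.I) =
      (Real.exp x : ℂ) * laplaceIntegrand A φ θ z (Real.exp x) := by
    intro θ hθ x
    simp only [hh, laplaceIntegrand]
    rw [hexp, hf.ext.borelTransform_ray hA hρ (hθA hθ) (Real.exp_pos x)]
    ring
  have hnorm : ∀ θ ∈ Icc θ₁ θ₂, ∀ x : ℝ, ‖h (x + θ * Complex.I)‖ ≤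
      β * (Real.exp x * Real.exp (-δ * Real.exp x)) := by
    intro θ hθ x
    rw [hline θ hθ, norm_mul, Complex.norm_real, Real.norm_of_nonneg (Real.exp_pos x).le]
    have h1 := hf.norm_laplaceIntegrand_le hA hρ (hθA hθ) z (Real.exp_pos x)
    have h2 : Real.exp ((τ - (z * Complex.exp ((θ : ℂ) * Complex.I)).re) * Real.exp x) ≤
        Real.exp (-δ * Real.exp x) := Real.exp_le_exp.2
      (mul_le_mul_of_nonneg_right (by linarith [hz θ hθ]) (Real.exp_pos x).le)
    calc _ ≤ Real.exp x * (β * Real.exp (-δ * Real.exp x)) :=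
          mul_le_mul_of_nonneg_left (h1.trans (mul_le_mul_of_nonneg_left h2 hβ))
            (Real.exp_pos x).le
      _ = _ := by ring
  have hmem : ∀ θ ∈ Icc θ₁ θ₂, z ∈ halfPlane τ θ := fun θ hθ =>
    lt_of_lt_of_le (by linarith) (hz θ hθ)
  have hconv : ∀ θ ∈ Icc θ₁ θ₂, Tendsto (fun X : ℝ => ∫ x in (-X)..X, h (x + θ * Complex.I)) atTop
      (𝓝 (∫ r in Ioi (0 : ℝ), laplaceIntegrand A φ θ z r)) := by
    intro θ hθ
    obtain ⟨hi, he⟩ := integral_laplaceIntegrand_comp_exp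
      (hf.integrableOn_laplaceIntegrand hA hρ (hθA hθ) (hmem θ hθ))
    rw [← he]
    simp only [hline θ hθ]
    exact intervalIntegral_tendsto_integral hi tendsto_neg_atTop_atBot tendsto_id
  have hvert : ∀ {l : ℝ → ℝ}, Tendsto (fun X => Real.exp (l X) * Real.exp (-δ * Real.exp (l X)))
      atTop (𝓝 0) → Tendsto (fun X : ℝ => ∫ y in θ₁..θ₂, h ((l X : ℝ) + y * Complex.I)) atTop
      (𝓝 0) := by
    intro l hl
    have hb : Tendsto (fun X => β * (Real.exp (l X) * Real.exp (-δ * Real.exp (l X))) * |θ₂ - θ₁|)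
        atTop (𝓝 0) := by
      simpa using (hl.const_mul β).mul_const |θ₂ - θ₁|
    refine squeeze_zero_norm (fun X => ?_) hb
    refine intervalIntegral.norm_integral_le_of_norm_le_const fun y hy => ?_
    rw [uIoc_of_le hθ] at hy
    exact hnorm y (Ioc_subset_Icc_self hy) _
  have hright := hvert (l := fun X => X) (by
    have := (tendsto_rpow_mul_exp_neg_mul_atTop_nhds_zero 1 δ hδ).comp Real.tendsto_exp_atTop
    simpa [Function.comp_def] using this)
  have hleft := hvert (l := fun X => -X) (by
    have h0 : Tendsto (fun X : ℝ => Real.exp (-X)) atTop (𝓝 0) :=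
      Real.tendsto_exp_atBot.comp tendsto_neg_atTop_atBot
    have h1 : Tendsto (fun X : ℝ => Real.exp (-δ * Real.exp (-X))) atTop (𝓝 1) := by
      have := (Real.continuous_exp.tendsto _).comp (h0.const_mul (-δ))
      simpa [Function.comp_def] using this
    simpa using h0.mul h1)
  have hdiff : DifferentiableOn ℂ h (Complex.im ⁻¹' Icc θ₁ θ₂) := by
    have : MapsTo Complex.exp (Complex.im ⁻¹' Icc θ₁ θ₂) (sector ρ A) := fun s hs => by
      rw [exp_eq_ray]
      exact ray_mem_sector (hθA hs) (Real.exp_pos _)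
    exact ((hf.ext.1.comp Complex.differentiable_exp.differentiableOn this).mul
      (by fun_prop)).mul Complex.differentiable_exp.differentiableOn
  -- The vertical sides of the rectangle are arcs of radii `e^X` and `e^(-X)` in the Borel plane.
  have hrect : ∀ X : ℝ, (∫ x in (-X)..X, h (x + θ₁ * Complex.I)) -
      (∫ x in (-X)..X, h (x + θ₂ * Complex.I)) +
      Complex.I • (∫ y in θ₁..θ₂, h ((X : ℝ) + y * Complex.I)) -
      Complex.I • (∫ y in θ₁..θ₂, h (((-X : ℝ) : ℂ) + y * Complex.I)) = 0 := by
    intro X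
    have := Complex.integral_boundary_rect_eq_zero_of_differentiableOn h ⟨-X, θ₁⟩ ⟨X, θ₂⟩
      (hdiff.mono fun s hs => by
        have := hs.2
        rwa [uIcc_of_le hθ] at this)
    exact this
  have hlim := (((hconv θ₁ (left_mem_Icc.2 hθ)).sub (hconv θ₂ (right_mem_Icc.2 hθ))).add
    (hright.const_smul Complex.I)).sub (hleft.const_smul Complex.I)
  simp only [hrect, smul_zero, add_zero, sub_zero] at hlim
  have h0 := tendsto_nhds_unique hlim tendsto_const_nhds
  unfold laplaceSum
  rw [sub_eq_zero.1 h0]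

theorem re_mul_exp_ge_neg_norm (z : ℂ) (θ : ℝ) :
    -‖z‖ ≤ (z * Complex.exp ((θ : ℂ) * Complex.I)).re := by
  have := Complex.abs_re_le_norm (z * Complex.exp ((θ : ℂ) * Complex.I))
  rw [norm_mul, Complex.norm_exp_ofReal_mul_I, mul_one] at this
  exact neg_le_of_abs_le this

/-- For `τ < 0` all the half-planes contain the disc of radius `-τ`, where the path may be rotated
freely; the equality spreads to the intersection of two half-planes since it is connected. -/
theorem IsBoundedExtension.laplaceSum_eq_of_neg (hA : IsOpen A) (hA' : A.OrdConnected) (hρ : 0 < ρ)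
    (hf : IsBoundedExtension A ρ τ φ f β) (hβ : 0 ≤ β) (hτ : τ < 0) {θ₁ θ₂ : ℝ} (h₁ : θ₁ ∈ A)
    (h₂ : θ₂ ∈ A) (hθ : θ₁ ≤ θ₂) (hz₁ : z ∈ halfPlane τ θ₁) (hz₂ : z ∈ halfPlane τ θ₂) :
    laplaceSum A φ θ₁ z = laplaceSum A φ θ₂ z := by
  have hd₁ := (hf.differentiableOn_laplaceSum hA hρ hβ h₁).analyticOnNhd (isOpen_halfPlane τ θ₁)
  have hd₂ := (hf.differentiableOn_laplaceSum hA hρ hβ h₂).analyticOnNhd (isOpen_halfPlane τ θ₂)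
  refine AnalyticOnNhd.eqOn_of_preconnected_of_eventuallyEq (hd₁.mono inter_subset_left)
    (hd₂.mono inter_subset_right)
    ((convex_halfPlane τ θ₁).inter (convex_halfPlane τ θ₂)).isPreconnected
    (z₀ := 0) ⟨by simpa [halfPlane] using hτ, by simpa [halfPlane] using hτ⟩ ?_ ⟨hz₁, hz₂⟩
  filter_upwards [Metric.ball_mem_nhds (0 : ℂ) (neg_pos.2 hτ)] with x hx
  rw [mem_ball_zero_iff] at hx
  exact hf.laplaceSum_eq_of_forall_mem_Icc hA hρ hβ hθ (δ := -τ - ‖x‖) (by linarith)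
    (hA'.out h₁ h₂) fun θ _ => by linarith [re_mul_exp_ge_neg_norm x θ]

theorem re_mul_exp_eq_of_arg_sub_eq {t : ℝ}
    (h : (z * Complex.exp ((θ : ℂ) * Complex.I)).arg - θ = t) (θ' : ℝ) :
    (z * Complex.exp ((θ' : ℂ) * Complex.I)).re = ‖z‖ * Real.cos (t + θ') := by
  have hz : z * Complex.exp ((θ : ℂ) * Complex.I) =
      ‖z‖ * Complex.exp (((t + θ : ℝ) : ℂ) * Complex.I) := by
    rw [← h, sub_add_cancel]
    conv_lhs => rw [← Complex.norm_mul_exp_arg_mul_I (z * Complex.exp ((θ : ℂ) * Complex.I))]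
    rw [norm_mul, Complex.norm_exp_ofReal_mul_I, mul_one]
  have hz' : z * Complex.exp ((θ' : ℂ) * Complex.I) =
      ‖z‖ * Complex.exp (((t + θ' : ℝ) : ℂ) * Complex.I) := by
    calc z * Complex.exp ((θ' : ℂ) * Complex.I) = z * Complex.exp ((θ : ℂ) * Complex.I) *
          Complex.exp (((θ' - θ : ℝ) : ℂ) * Complex.I) := by
          rw [mul_assoc, ← Complex.exp_add]
          congr 2
          push_cast
          ring
      _ = _ := by
          rw [hz, mul_assoc, ← Complex.exp_add]
          congr 2
          push_cast
          ring
  rw [hz', Complex.re_ofReal_mul, Complex.exp_ofReal_mul_I_re]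

/-- For `τ ≥ 0` two directions whose half-planes share a point of the Riemann surface of the
logarithm differ by less than `π`, and that point lies in the half-planes of all directions in
between. -/
theorem IsBoundedExtension.laplaceSum_eq_of_nonneg (hA : IsOpen A) (hA' : A.OrdConnected)
    (hρ : 0 < ρ) (hf : IsBoundedExtension A ρ τ φ f β) (hβ : 0 ≤ β) (hτ : 0 ≤ τ) {θ₁ θ₂ : ℝ}
    (h₁ : θ₁ ∈ A) (h₂ : θ₂ ∈ A) (hθ : θ₁ ≤ θ₂) (hz₁ : z ∈ halfPlane τ θ₁)
    (hz₂ : z ∈ halfPlane τ θ₂) (harg : (z * Complex.exp ((θ₁ : ℂ) * Complex.I)).arg - θ₁ =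
      (z * Complex.exp ((θ₂ : ℂ) * Complex.I)).arg - θ₂) :
    laplaceSum A φ θ₁ z = laplaceSum A φ θ₂ z := by
  set t := (z * Complex.exp ((θ₁ : ℂ) * Complex.I)).arg - θ₁ with ht
  have hre := re_mul_exp_eq_of_arg_sub_eq ht.symm
  have hbd : ∀ {θ : ℝ}, z ∈ halfPlane τ θ →
      (z * Complex.exp ((θ : ℂ) * Complex.I)).arg - θ = t →
      t + θ ∈ Icc (-(Real.pi / 2)) (Real.pi / 2) := by
    intro θ hz h
    have : |(z * Complex.exp ((θ : ℂ) * Complex.I)).arg| ≤ Real.pi / 2 :=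
      Complex.abs_arg_le_pi_div_two_iff.2 (hτ.trans (le_of_lt hz))
    rw [← h, sub_add_cancel]
    exact abs_le.1 this
  have b₁ := hbd hz₁ rfl
  have b₂ := hbd hz₂ harg.symm
  have hz₁' : τ < ‖z‖ * Real.cos (t + θ₁) := by rw [← hre]; exact hz₁
  have hz₂' : τ < ‖z‖ * Real.cos (t + θ₂) := by rw [← hre]; exact hz₂
  set m := min (‖z‖ * Real.cos (t + θ₁)) (‖z‖ * Real.cos (t + θ₂)) with hm
  have hm0 : τ < m := lt_min hz₁' hz₂'
  refine hf.laplaceSum_eq_of_forall_mem_Icc hA hρ hβ hθ (δ := m - τ) (by linarith)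
    (hA'.out h₁ h₂) fun θ hθ' => ?_
  rw [hre, add_sub_cancel, hm, ← mul_min_of_nonneg _ _ (norm_nonneg z)]
  refine mul_le_mul_of_nonneg_left ?_ (norm_nonneg z)
  have hconc : ConcaveOn ℝ (Icc (-(Real.pi / 2)) (Real.pi / 2)) Real.cos :=
    strictConcaveOn_cos_Icc.concaveOn
  refine hconc.min_le_of_mem_segment b₁ b₂ ?_
  rw [segment_eq_Icc (by linarith)]
  exact ⟨by linarith [hθ'.1], by linarith [hθ'.2]⟩

/-- A bounded extension makes the Borel sum well defined. -/
theorem IsBoundedExtension.borelSumWellDefined (hA : IsOpen A) (hA' : A.OrdConnected)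
    (hρ : 0 < ρ) (hf : IsBoundedExtension A ρ τ φ f β) (hβ : 0 ≤ β) :
    BorelSumWellDefined A τ φ := by
  intro θ hθ z hz
  refine ⟨hf.integrableOn_laplaceIntegrand hA hρ hθ hz, ?_⟩
  have hex : ∃ θ' ∈ A, (chart τ θ z).1 ∈ halfPlane τ θ' ∧
      chart τ θ' (chart τ θ z).1 = chart τ θ z := ⟨θ, hθ, hz, rfl⟩
  unfold borelSum
  rw [dif_pos hex]
  obtain ⟨h₁, h₂, h₃⟩ := Classical.choose_spec hex
  generalize Classical.choose hex = θ' at h₁ h₂ h₃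
  change z ∈ halfPlane τ θ' at h₂
  change laplaceSum A φ θ' z = _
  by_cases hτ : τ < 0
  · rcases le_total θ θ' with h | h
    · exact (hf.laplaceSum_eq_of_neg hA hA' hρ hβ hτ hθ h₁ h hz h₂).symm
    · exact hf.laplaceSum_eq_of_neg hA hA' hρ hβ hτ h₁ hθ h h₂ hz
  · simp only [chart, hτ, if_false, Prod.mk.injEq, true_and] at h₃
    rcases le_total θ θ' with h | h
    · exact (hf.laplaceSum_eq_of_nonneg hA hA' hρ hβ (not_lt.1 hτ) hθ h₁ h hz h₂ h₃.symm).symm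
    · exact hf.laplaceSum_eq_of_nonneg hA hA' hρ hβ (not_lt.1 hτ) h₁ hθ h h₂ hz h₃

end

/-! ### Borel sums of products -/

section

variable {A : Set ℝ} {ρ τ β θ : ℝ} {φ ψ : ℂ⟦X⟧} {f g : ℂ → ℂ} {z : ℂ}

/-- On a ray, the Laplace kernel turns convolution along segments into convolution on `(0, ∞)`. -/
theorem segmentConv_mul_exp_eq_integral (hA : IsOpen A) (hρ : 0 < ρ) (hf : IsBorelExtension A ρ φ f)
    (hg : IsBorelExtension A ρ ψ g) (hθ : θ ∈ A) (z : ℂ) {r : ℝ} (hr : 0 < r) :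
    segmentConv f g ((r : ℂ) * Complex.exp ((θ : ℂ) * Complex.I)) *
      Complex.exp (-z * ((r : ℂ) * Complex.exp ((θ : ℂ) * Complex.I))) *
      Complex.exp ((θ : ℂ) * Complex.I) =
    ∫ s in (0 : ℝ)..r, laplaceIntegrand A ψ θ z s * laplaceIntegrand A φ θ z (r - s) := by
  set e := Complex.exp ((θ : ℂ) * Complex.I) with he
  have h1 : ∫ s in (0 : ℝ)..r, laplaceIntegrand A ψ θ z s * laplaceIntegrand A φ θ z (r - s) =
      (r : ℂ) * ∫ t in (0 : ℝ)..1, laplaceIntegrand A ψ θ z (r * t) *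
        laplaceIntegrand A φ θ z (r - r * t) := by
    have := intervalIntegral.smul_integral_comp_mul_left (a := 0) (b := 1)
      (fun s => laplaceIntegrand A ψ θ z s * laplaceIntegrand A φ θ z (r - s)) r
    rw [mul_zero, mul_one, Complex.real_smul] at this
    exact this.symm
  have h2 : ∫ t in (0 : ℝ)..1, laplaceIntegrand A ψ θ z (r * t) *
        laplaceIntegrand A φ θ z (r - r * t) =
      ∫ t in (0 : ℝ)..1, f (((1 - t : ℝ) : ℂ) * (r * e)) * g ((t : ℂ) * (r * e)) *
        (Complex.exp (-z * (r * e)) * e * e) := by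
    rw [intervalIntegral.integral_of_le zero_le_one, intervalIntegral.integral_of_le zero_le_one,
      integral_Ioc_eq_integral_Ioo, integral_Ioc_eq_integral_Ioo]
    refine setIntegral_congr_fun measurableSet_Ioo fun t ht => ?_
    have ht1 : 0 < r * t := mul_pos hr ht.1
    have ht2 : 0 < r - r * t := by nlinarith [ht.2]
    simp only [laplaceIntegrand, hf.borelTransform_ray hA hρ hθ ht2,
      hg.borelTransform_ray hA hρ hθ ht1]
    rw [← he]
    have e1 : ((r * t : ℝ) : ℂ) * e = t * (r * e) := by push_cast; ring
    have e2 : ((r - r * t : ℝ) : ℂ) * e = ((1 - t : ℝ) : ℂ) * (r * e) := by push_cast; ring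
    have e3 : Complex.exp (-z * (r * e)) = Complex.exp (-z * (t * (r * e))) *
        Complex.exp (-z * (((1 - t : ℝ) : ℂ) * (r * e))) := by
      rw [← Complex.exp_add]
      congr 1
      push_cast
      ring
    rw [e1, e2, e3]
    ring
  rw [h1, h2, intervalIntegral.integral_mul_const, segmentConv]
  ring

/-- The Borel sum of a product is the product of the Borel sums. -/
theorem IsBorelExtension.laplaceSum_mul (hA : IsOpen A) (hρ : 0 < ρ)
    (hf : IsBorelExtension A ρ φ f) (hg : IsBorelExtension A ρ ψ g) (hθ : θ ∈ A)
    (hif : IntegrableOn (laplaceIntegrand A φ θ z) (Ioi 0))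
    (hig : IntegrableOn (laplaceIntegrand A ψ θ z) (Ioi 0)) :
    IntegrableOn (laplaceIntegrand A (φ * ψ) θ z) (Ioi 0) ∧
      laplaceSum A (φ * ψ) θ z = laplaceSum A φ θ z * laplaceSum A ψ θ z := by
  have heq : EqOn (laplaceIntegrand A (φ * ψ) θ z) (fun r =>
      PowerSeries.constantCoeff φ * laplaceIntegrand A ψ θ z r +
      PowerSeries.constantCoeff ψ * laplaceIntegrand A φ θ z r +
      ∫ s in (0 : ℝ)..r, laplaceIntegrand A ψ θ z s * laplaceIntegrand A φ θ z (r - s))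
      (Ioi 0) := by
    intro r hr
    beta_reduce
    rw [← segmentConv_mul_exp_eq_integral hA hρ hf hg hθ z hr]
    simp only [laplaceIntegrand, (hf.mul hA hρ hg).borelTransform_ray hA hρ hθ hr,
      hf.borelTransform_ray hA hρ hθ hr, hg.borelTransform_ray hA hρ hθ hr]
    ring
  have hic : IntegrableOn (fun r : ℝ => ∫ s in (0 : ℝ)..r, laplaceIntegrand A ψ θ z s *
      laplaceIntegrand A φ θ z (r - s)) (Ioi 0) := by
    have := (integrable_posConvolution (μ := volume) (ν := volume) hig hif
      (ContinuousLinearMap.mul ℝ ℂ)).integrableOn (s := Ioi 0)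
    refine this.congr_fun (fun r hr => ?_) measurableSet_Ioi
    simp [posConvolution, indicator_of_mem hr]
  have hval := integral_posConvolution (μ := volume) (ν := volume) hig hif
    (ContinuousLinearMap.mul ℝ ℂ)
  simp only [ContinuousLinearMap.mul_apply'] at hval
  have h12 : IntegrableOn (fun r => PowerSeries.constantCoeff φ * laplaceIntegrand A ψ θ z r +
      PowerSeries.constantCoeff ψ * laplaceIntegrand A φ θ z r) (Ioi 0) :=
    (hig.const_mul (PowerSeries.constantCoeff φ)).add (hif.const_mul (PowerSeries.constantCoeff ψ))
  refine ⟨IntegrableOn.congr_fun (h12.add hic) heq.symm measurableSet_Ioi, ?_⟩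
  unfold laplaceSum
  rw [setIntegral_congr_fun measurableSet_Ioi heq, integral_add h12 hic,
    integral_add (hig.const_mul _) (hif.const_mul _), hval, integral_const_mul,
    integral_const_mul, map_mul]
  ring

end

/-! ### Majorants, sums over multi-indices and formal substitution -/

section

section Majorant

/-- The function `α x^(n-1)/(n-1)! + β x^n/n!`, where the first summand is absent for `n = 0`. It
is the `n`-fold iterated integral of the distribution `α δ + β` on `[0, ∞)`, hence it bounds the
convolution of a constant term `α` and a function bounded by `β` with `n` functions bounded
by `1`. -/
def expMajorant (α β : ℝ) (n : ℕ) (x : ℝ) : ℝ :=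
  α * (n * x ^ (n - 1) / n.factorial) + β * (x ^ n / n.factorial)

theorem expMajorant_succ (α β : ℝ) (n : ℕ) (x : ℝ) : expMajorant α β (n + 1) x =
    α * (x ^ n / n.factorial) + β * (x ^ (n + 1) / (n + 1).factorial) := by
  have h1 : (n.factorial : ℝ) ≠ 0 := by exact_mod_cast n.factorial_ne_zero
  have h2 : ((n : ℝ) + 1) ≠ 0 := by positivity
  unfold expMajorant
  rw [Nat.factorial_succ, Nat.add_sub_cancel]
  push_cast
  field_simp

theorem continuous_expMajorant (α β : ℝ) (n : ℕ) : Continuous (expMajorant α β n) := by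
  unfold expMajorant
  fun_prop

theorem hasDerivAt_expMajorant_succ (α β : ℝ) (n : ℕ) (x : ℝ) :
    HasDerivAt (expMajorant α β (n + 1)) (expMajorant α β n x) x := by
  have h := (((hasDerivAt_pow n x).div_const (n.factorial : ℝ)).const_mul α).add
    (((hasDerivAt_pow (n + 1) x).div_const ((n + 1).factorial : ℝ)).const_mul β)
  have he : expMajorant α β (n + 1) = (fun x : ℝ => α * (x ^ n / n.factorial)) +
      fun x => β * (x ^ (n + 1) / (n + 1).factorial) := funext fun x => expMajorant_succ α β n x
  rw [he]
  refine h.congr_deriv ?_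
  have h1 : (n.factorial : ℝ) ≠ 0 := by exact_mod_cast n.factorial_ne_zero
  have h2 : ((n : ℝ) + 1) ≠ 0 := by positivity
  unfold expMajorant
  rw [Nat.factorial_succ, Nat.add_sub_cancel]
  push_cast
  field_simp

theorem expMajorant_nonneg {α β : ℝ} (hα : 0 ≤ α) (hβ : 0 ≤ β) (n : ℕ) {x : ℝ} (hx : 0 ≤ x) :
    0 ≤ expMajorant α β n x := by
  unfold expMajorant
  positivity

theorem expMajorant_mono {α β α' β' : ℝ} (hα : α ≤ α') (hβ : β ≤ β') (n : ℕ) {x : ℝ}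
    (hx : 0 ≤ x) : expMajorant α β n x ≤ expMajorant α' β' n x := by
  unfold expMajorant
  gcongr

theorem expMajorant_mul (c α β : ℝ) (n : ℕ) (x : ℝ) :
    expMajorant (c * α) (c * β) n x = c * expMajorant α β n x := by
  unfold expMajorant
  ring

theorem hasSum_pow_mul_expMajorant (α β y x : ℝ) :
    HasSum (fun n : ℕ => y ^ n * expMajorant α β n x) ((α * y + β) * Real.exp (y * x)) := by
  have hexp : HasSum (fun n : ℕ => (y * x) ^ n / n.factorial) (Real.exp (y * x)) := by
    rw [Real.exp_eq_exp_ℝ]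
    exact NormedSpace.expSeries_div_hasSum_exp (y * x)
  have h1 : HasSum (fun n : ℕ => y ^ n * (n * x ^ (n - 1) / n.factorial))
      (y * Real.exp (y * x)) := by
    rw [← hasSum_nat_add_iff' 1]
    simp only [Finset.range_one, Finset.sum_singleton, Nat.cast_zero, zero_mul, zero_div,
      mul_zero, sub_zero, Nat.add_sub_cancel]
    refine (hexp.mul_left y).congr_fun fun n => ?_
    have h1 : (n.factorial : ℝ) ≠ 0 := by exact_mod_cast n.factorial_ne_zero
    have h2 : ((n : ℝ) + 1) ≠ 0 := by positivity
    rw [Nat.factorial_succ]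
    push_cast
    field_simp
    ring
  have h := (h1.mul_left α).add (hexp.mul_left β)
  rw [show α * (y * Real.exp (y * x)) + β * Real.exp (y * x) =
    (α * y + β) * Real.exp (y * x) by ring] at h
  refine h.congr_fun fun n => ?_
  unfold expMajorant
  ring

/-- A series over multi-indices whose weights depend on `|k|` only is dominated by a series in one
variable: by the multinomial theorem the monomials of degree `n` sum up to at most
`(N₁ + ⋯ + N_r)^n`. -/
theorem sum_prod_pow_mul_le {r : ℕ} {N : Fin r → ℝ} (hN : ∀ j, 0 ≤ N j) {u : ℕ → ℝ}
    (hu : ∀ n, 0 ≤ u n) {S : ℝ} (hS : HasSum (fun n => (∑ j, N j) ^ n * u n) S)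
    (s : Finset (Fin r →₀ ℕ)) : ∑ k ∈ s, (∏ j, N j ^ k j) * u (∑ j, k j) ≤ S := by
  classical
  have hfib : ∀ n, ∑ k ∈ s with ∑ j, k j = n, ∏ j, N j ^ k j ≤ (∑ j, N j) ^ n := by
    intro n
    have h0 : ∀ k : Fin r → ℕ, 0 ≤ ∏ j, N j ^ k j := fun k =>
      Finset.prod_nonneg fun j _ => pow_nonneg (hN j) _
    rw [Finset.sum_pow_eq_sum_piAntidiag]
    calc ∑ k ∈ s with ∑ j, k j = n, ∏ j, N j ^ k j
        = ∑ k ∈ (s.filter fun k => ∑ j, k j = n).image (fun k : Fin r →₀ ℕ => ⇑k),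
            ∏ j, N j ^ k j := by
          rw [Finset.sum_image (DFunLike.coe_injective.injOn)]
      _ ≤ ∑ k ∈ Finset.piAntidiag Finset.univ n, ∏ j, N j ^ k j := by
          refine Finset.sum_le_sum_of_subset_of_nonneg ?_ fun k _ _ => h0 k
          intro k hk
          obtain ⟨k', hk', rfl⟩ := Finset.mem_image.1 hk
          simpa using (Finset.mem_filter.1 hk').2
      _ ≤ _ := by
          refine Finset.sum_le_sum fun k _ => le_mul_of_one_le_left (h0 k) ?_
          exact_mod_cast Nat.multinomial_pos _ _
  calc ∑ k ∈ s, (∏ j, N j ^ k j) * u (∑ j, k j)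
      = ∑ n ∈ s.image (fun k => ∑ j, k j), ∑ k ∈ s with ∑ j, k j = n,
          (∏ j, N j ^ k j) * u (∑ j, k j) :=
        (Finset.sum_fiberwise_of_maps_to (fun k hk => Finset.mem_image_of_mem _ hk) _).symm
    _ ≤ ∑ n ∈ s.image (fun k => ∑ j, k j), (∑ j, N j) ^ n * u n := by
        refine Finset.sum_le_sum fun n _ => ?_
        rw [Finset.sum_congr rfl fun k hk => by rw [(Finset.mem_filter.1 hk).2], ← Finset.sum_mul]
        exact mul_le_mul_of_nonneg_right (hfib n) (hu n)
    _ ≤ S := sum_le_hasSum _ (fun n _ => mul_nonneg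
        (pow_nonneg (Finset.sum_nonneg fun j _ => hN j) _) (hu n)) hS

end Majorant

section Series

variable {ι : Type*} {F : ι → ℂ → ℂ} {U : Set ℂ} {u : ι → ℝ}

theorem differentiableOn_iteratedDeriv (hU : IsOpen U) {g : ℂ → ℂ} (hg : DifferentiableOn ℂ g U)
    (n : ℕ) : DifferentiableOn ℂ (iteratedDeriv n g) U := by
  induction n with
  | zero => simpa using hg
  | succ n ih =>
    rw [iteratedDeriv_succ]
    exact ih.deriv hU

theorem hasSum_iteratedDeriv_of_summable_norm (hu : Summable u)
    (hF : ∀ i, DifferentiableOn ℂ (F i) U) (hU : IsOpen U)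
    (hle : ∀ i, ∀ w ∈ U, ‖F i w‖ ≤ u i) {z : ℂ} (hz : z ∈ U) (n : ℕ) :
    HasSum (fun i => iteratedDeriv n (F i) z) (iteratedDeriv n (fun w => ∑' i, F i w) z) := by
  have hFs : ∀ s : Finset ι, DifferentiableOn ℂ (fun w => ∑ i ∈ s, F i w) U := fun s =>
    DifferentiableOn.fun_sum fun i _ => hF i
  have hc : TendstoLocallyUniformlyOn
      (fun s : Finset ι => iteratedDeriv n (fun w => ∑ i ∈ s, F i w))
      (iteratedDeriv n (fun w => ∑' i, F i w)) atTop U := by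
    induction n with
    | zero => simpa using (tendstoUniformlyOn_tsum hu hle).tendstoLocallyUniformlyOn
    | succ n ih =>
      simp only [iteratedDeriv_succ]
      exact ih.deriv (Eventually.of_forall fun s => differentiableOn_iteratedDeriv hU (hFs s) n) hU
  refine (hc.tendsto_at hz).congr fun s => ?_
  exact iteratedDeriv_fun_sum fun i _ => ((hF i).analyticAt (hU.mem_nhds hz)).contDiffAt

end Series

section Monomials

variable {r : ℕ}

theorem prod_pow_add_single {M : Type*} [CommMonoid M] (x : Fin r → M) (k : Fin r →₀ ℕ)
    (i : Fin r) : ∏ j, x j ^ (k + Finsupp.single i 1 : Fin r →₀ ℕ) j = (∏ j, x j ^ k j) * x i := by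
  simp only [Finsupp.add_apply, pow_add, Finset.prod_mul_distrib]
  simp [Finsupp.single_apply, pow_ite]

theorem sum_add_single (k : Fin r →₀ ℕ) (i : Fin r) :
    ∑ j, (k + Finsupp.single i 1 : Fin r →₀ ℕ) j = ∑ j, k j + 1 := by
  simp [Finset.sum_add_distrib, Finsupp.single_apply]

/-- Induction on a multi-index, adding one to one of its components at each step. -/
theorem multiIndex_induction {P : (Fin r →₀ ℕ) → Prop} (h0 : P 0)
    (hs : ∀ k i, P k → P (k + Finsupp.single i 1)) (k : Fin r →₀ ℕ) : P k := by
  obtain ⟨n, hn⟩ : ∃ n, ∑ j, k j = n := ⟨_, rfl⟩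
  induction n generalizing k with
  | zero =>
    have : k = 0 := by
      ext j
      exact (Finset.sum_eq_zero_iff.1 hn) j (Finset.mem_univ j)
    rwa [this]
  | succ n ih =>
    obtain ⟨i, -, hi⟩ := Finset.exists_ne_zero_of_sum_ne_zero (hn.trans_ne n.succ_ne_zero)
    have hk : k - Finsupp.single i 1 + Finsupp.single i 1 = k :=
      tsub_add_cancel_of_le (Finsupp.single_le_iff.2 (Nat.one_le_iff_ne_zero.2 hi))
    rw [← hk]
    refine hs _ _ (ih _ ?_)
    have := sum_add_single (k - Finsupp.single i 1) i
    rw [hk, hn] at this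
    omega

variable {φ : Fin r → ℂ⟦X⟧}

theorem X_pow_dvd_prod_pow (hφ0 : ∀ j, PowerSeries.constantCoeff (φ j) = 0)
    (k : Fin r →₀ ℕ) :
    (PowerSeries.X : ℂ⟦X⟧) ^ (∑ j, k j) ∣ ∏ j, φ j ^ k j := by
  rw [← Finset.prod_pow_eq_pow_sum]
  exact Finset.prod_dvd_prod_of_dvd _ _ fun j _ =>
    pow_dvd_pow_of_dvd (PowerSeries.X_dvd_iff.2 (hφ0 j)) _

theorem coeff_mul_prod_pow_eq_zero (hφ0 : ∀ j, PowerSeries.constantCoeff (φ j) = 0)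
    (ψ : ℂ⟦X⟧) {k : Fin r →₀ ℕ} {n : ℕ} (h : n < ∑ j, k j) :
    PowerSeries.coeff n (ψ * ∏ j, φ j ^ k j) = 0 :=
  PowerSeries.X_pow_dvd_iff.1 ((X_pow_dvd_prod_pow hφ0 k).mul_left ψ) n h

theorem finite_setOf_sum_le (n : ℕ) : {k : Fin r →₀ ℕ | ∑ j, k j ≤ n}.Finite := by
  refine (Set.finite_Iic (Finsupp.equivFunOnFinite.symm fun _ => n)).subset fun k hk j => ?_
  exact (Finset.single_le_sum (fun _ _ => Nat.zero_le _) (Finset.mem_univ j)).trans hk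

theorem hasSum_coeff_formalSubst (hφ0 : ∀ j, PowerSeries.constantCoeff (φ j) = 0)
    (H : MvPowerSeries (Fin r) ℂ⟦X⟧) (n : ℕ) :
    HasSum (fun k : Fin r →₀ ℕ =>
      PowerSeries.coeff n (MvPowerSeries.coeff k H * ∏ j, φ j ^ k j))
      (PowerSeries.coeff n (formalSubst H φ)) := by
  have hsupp : Function.support (fun k : Fin r →₀ ℕ =>
      PowerSeries.coeff n (MvPowerSeries.coeff k H * ∏ j, φ j ^ k j)) ⊆
      ((finite_setOf_sum_le (r := r) n).toFinset : Set (Fin r →₀ ℕ)) := by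
    intro k hk
    rw [Set.Finite.coe_toFinset]
    by_contra hlt
    exact hk (coeff_mul_prod_pow_eq_zero hφ0 _ (not_le.1 hlt))
  rw [formalSubst, PowerSeries.coeff_mk, finsum_eq_sum_of_support_subset _ hsupp]
  refine hasSum_sum_of_ne_finset_zero fun k hk => ?_
  by_contra hne
  exact hk (hsupp hne)

end Monomials

end

/-! ### The Borel transform and the Borel sum of `H(φ₁, …, φ_r)` -/

section

variable {A : Set ℝ} {ρ τ β a b θ : ℝ} {r : ℕ} {ψ : ℂ⟦X⟧} {φ : Fin r → ℂ⟦X⟧} {g : ℂ → ℂ}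
  {f : Fin r → ℂ → ℂ} {N : Fin r → ℝ} {z : ℂ}

/-- Each factor `φ_j` of norm at most `N_j` integrates the bound for the Borel transform once. -/
theorem exists_isBorelExtension_mul_prod_pow (hA : IsOpen A) (hρ : 0 < ρ)
    (hψ : IsBoundedExtension A ρ τ ψ g β)
    (hφ : ∀ j, IsBoundedExtension A ρ τ (φ j) (f j) (N j)) (hN : ∀ j, 0 ≤ N j)
    (hφ0 : ∀ j, PowerSeries.constantCoeff (φ j) = 0) (k : Fin r →₀ ℕ) :
    ∃ q, IsBorelExtension A ρ (ψ * ∏ j, φ j ^ k j) q ∧ ∀ ζ ∈ sector ρ A,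
      ‖q ζ‖ ≤ (∏ j, N j ^ k j) * expMajorant ‖PowerSeries.constantCoeff ψ‖ β (∑ j, k j) ‖ζ‖ *
        Real.exp (τ * ‖ζ‖) := by
  induction k using multiIndex_induction with
  | h0 => exact ⟨g, by simpa using hψ.ext, by simpa [expMajorant] using hψ.bound⟩
  | hs k i ih =>
    obtain ⟨q, hq, hqb⟩ := ih
    have hext := hq.mul hA hρ (hφ i).ext
    rw [mul_assoc, ← prod_pow_add_single] at hext
    refine ⟨_, hext, fun ζ hζ => ?_⟩
    rw [prod_pow_add_single, sum_add_single, hφ0 i, zero_mul, add_zero]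
    set c := ‖PowerSeries.constantCoeff ψ‖
    set P := ∏ j, N j ^ k j with hP
    set n := ∑ j, k j with hn
    have hP0 : 0 ≤ P := Finset.prod_nonneg fun j _ => pow_nonneg (hN j) _
    have hconv := norm_segmentConv_le (f := q) (g := f i) (τ := τ) (b := N i) (ζ := ζ)
      (p := fun x => P * expMajorant c β n x) (P := fun x => P * expMajorant c β (n + 1) x)
      ((continuous_expMajorant c β n).const_mul P)
      (fun x => (hasDerivAt_expMajorant_succ c β n x).const_mul P)
      (fun t ht => hqb _ (smul_mem_sector hρ hζ ht.1 ht.2))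
      (fun t ht => (hφ i).bound _ (smul_mem_sector hρ hζ ht.1 ht.2))
    -- The constant term of `ψ φ^k` vanishes unless `k = 0`, like the majorant at `0`.
    have hconst : ‖PowerSeries.constantCoeff (ψ * ∏ j, φ j ^ k j)‖ ≤
        P * expMajorant c β (n + 1) 0 := by
      rcases Nat.eq_zero_or_pos n with h0 | hpos
      · have hk : ∀ j, k j = 0 := fun j => (Finset.sum_eq_zero_iff.1 (hn ▸ h0)) j
          (Finset.mem_univ j)
        simp [hP, hk, h0, expMajorant, c]
      · rw [← PowerSeries.coeff_zero_eq_constantCoeff_apply, coeff_mul_prod_pow_eq_zero hφ0 ψ hpos,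
          norm_zero]
        have : expMajorant c β (n + 1) 0 = 0 := by
          rw [expMajorant_succ]
          simp [hpos.ne']
        rw [this, mul_zero]
    have hfi := (hφ i).bound ζ hζ
    calc _ ≤ ‖PowerSeries.constantCoeff (ψ * ∏ j, φ j ^ k j)‖ * ‖f i ζ‖ +
          ‖segmentConv q (f i) ζ‖ := by
          rw [← norm_mul]
          exact norm_add_le _ _
      _ ≤ (P * expMajorant c β (n + 1) 0) * (N i * Real.exp (τ * ‖ζ‖)) +
          N i * (P * expMajorant c β (n + 1) ‖ζ‖ - P * expMajorant c β (n + 1) 0) *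
            Real.exp (τ * ‖ζ‖) :=
          add_le_add (mul_le_mul hconst hfi (norm_nonneg _) ((norm_nonneg _).trans hconst)) hconv
      _ = _ := by ring

theorem laplaceSum_mul_prod_pow (hA : IsOpen A) (hρ : 0 < ρ)
    (hψ : IsBoundedExtension A ρ τ ψ g β)
    (hφ : ∀ j, IsBoundedExtension A ρ τ (φ j) (f j) (N j)) (hN : ∀ j, 0 ≤ N j)
    (hφ0 : ∀ j, PowerSeries.constantCoeff (φ j) = 0) (hθ : θ ∈ A) (hz : z ∈ halfPlane τ θ)
    (k : Fin r →₀ ℕ) :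
    IntegrableOn (laplaceIntegrand A (ψ * ∏ j, φ j ^ k j) θ z) (Ioi 0) ∧
      laplaceSum A (ψ * ∏ j, φ j ^ k j) θ z =
        laplaceSum A ψ θ z * ∏ j, laplaceSum A (φ j) θ z ^ k j := by
  induction k using multiIndex_induction with
  | h0 => simpa using hψ.integrableOn_laplaceIntegrand hA hρ hθ hz
  | hs k i ih =>
    obtain ⟨q, hq, -⟩ := exists_isBorelExtension_mul_prod_pow hA hρ hψ hφ hN hφ0 k
    have h := hq.laplaceSum_mul hA hρ (hφ i).ext hθ ih.1
      ((hφ i).integrableOn_laplaceIntegrand hA hρ hθ hz)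
    rw [prod_pow_add_single, prod_pow_add_single, ← mul_assoc, ← mul_assoc, ← ih.2]
    exact h

/-- The bound for the Borel transform of `H_k φ^k`, without the factor `e^{τx}`, when the norm
of `H_k` is at most `a b^|k|` and that of `φ_j` is at most `N_j`. -/
def termMajorant (a b : ℝ) (N : Fin r → ℝ) (k : Fin r →₀ ℕ) (x : ℝ) : ℝ :=
  (∏ j, N j ^ k j) * (b ^ (∑ j, k j) * expMajorant a a (∑ j, k j) x)

theorem termMajorant_nonneg (ha : 0 ≤ a) (hb : 0 ≤ b) (hN : ∀ j, 0 ≤ N j) (k : Fin r →₀ ℕ) {x : ℝ}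
    (hx : 0 ≤ x) : 0 ≤ termMajorant a b N k x :=
  mul_nonneg (Finset.prod_nonneg fun j _ => pow_nonneg (hN j) _)
    (mul_nonneg (pow_nonneg hb _) (expMajorant_nonneg ha ha _ hx))

theorem termMajorant_mono (ha : 0 ≤ a) (hb : 0 ≤ b) (hN : ∀ j, 0 ≤ N j) (k : Fin r →₀ ℕ) {x y : ℝ}
    (hx : 0 ≤ x) (hxy : x ≤ y) : termMajorant a b N k x ≤ termMajorant a b N k y := by
  refine mul_le_mul_of_nonneg_left (mul_le_mul_of_nonneg_left ?_ (pow_nonneg hb _))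
    (Finset.prod_nonneg fun j _ => pow_nonneg (hN j) _)
  unfold expMajorant
  gcongr

theorem sum_termMajorant_le (ha : 0 ≤ a) (hb : 0 ≤ b) (hN : ∀ j, 0 ≤ N j) {x : ℝ} (hx : 0 ≤ x)
    (s : Finset (Fin r →₀ ℕ)) :
    ∑ k ∈ s, termMajorant a b N k x ≤ a * (1 + b * ∑ j, N j) * Real.exp (b * (∑ j, N j) * x) := by
  refine sum_prod_pow_mul_le hN (u := fun n => b ^ n * expMajorant a a n x)
    (fun n => mul_nonneg (pow_nonneg hb _) (expMajorant_nonneg ha ha _ hx)) ?_ s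
  have h := hasSum_pow_mul_expMajorant a a (b * ∑ j, N j) x
  rw [show a * (b * ∑ j, N j) + a = a * (1 + b * ∑ j, N j) by ring] at h
  refine h.congr_fun fun n => ?_
  rw [mul_pow]
  ring

theorem summable_termMajorant (ha : 0 ≤ a) (hb : 0 ≤ b) (hN : ∀ j, 0 ≤ N j) {x : ℝ} (hx : 0 ≤ x) :
    Summable fun k => termMajorant a b N k x :=
  summable_of_sum_le (fun k => termMajorant_nonneg ha hb hN k hx)
    (sum_termMajorant_le ha hb hN hx)

/-- The Borel transforms `q_k` of the terms `H_k φ^k`, together with the bounds that make their sum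
over `k` converge. -/
structure IsTermFamily (A : Set ℝ) (ρ τ a b : ℝ) (N : Fin r → ℝ)
    (H : MvPowerSeries (Fin r) ℂ⟦X⟧) (φ : Fin r → ℂ⟦X⟧) (q : (Fin r →₀ ℕ) → ℂ → ℂ) : Prop where
  ext : ∀ k, IsBorelExtension A ρ (MvPowerSeries.coeff k H * ∏ j, φ j ^ k j) (q k)
  bound : ∀ k, ∀ ζ ∈ sector ρ A, ‖q k ζ‖ ≤ termMajorant a b N k ‖ζ‖ * Real.exp (τ * ‖ζ‖)

variable {H : MvPowerSeries (Fin r) ℂ⟦X⟧} {q : (Fin r →₀ ℕ) → ℂ → ℂ}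

theorem exists_isTermFamily (hA : IsOpen A) (hρ : 0 < ρ)
    (hH : ∀ k, ∃ h β, IsBoundedExtension A ρ τ (MvPowerSeries.coeff k H) h β ∧ 0 ≤ β ∧
      ‖PowerSeries.constantCoeff (MvPowerSeries.coeff k H)‖ + β ≤ a * b ^ (∑ j, k j))
    (hφ : ∀ j, IsBoundedExtension A ρ τ (φ j) (f j) (N j)) (hN : ∀ j, 0 ≤ N j)
    (hφ0 : ∀ j, PowerSeries.constantCoeff (φ j) = 0) :
    ∃ q, IsTermFamily A ρ τ a b N H φ q := by
  have key : ∀ k : Fin r →₀ ℕ, ∃ q,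
      IsBorelExtension A ρ (MvPowerSeries.coeff k H * ∏ j, φ j ^ k j) q ∧
      ∀ ζ ∈ sector ρ A, ‖q ζ‖ ≤ termMajorant a b N k ‖ζ‖ * Real.exp (τ * ‖ζ‖) := by
    intro k
    obtain ⟨h, β, hh, hβ, hle⟩ := hH k
    obtain ⟨q, hq, hqb⟩ := exists_isBorelExtension_mul_prod_pow hA hρ hh hφ hN hφ0 k
    refine ⟨q, hq, fun ζ hζ => (hqb ζ hζ).trans ?_⟩
    refine mul_le_mul_of_nonneg_right (mul_le_mul_of_nonneg_left ?_
      (Finset.prod_nonneg fun j _ => pow_nonneg (hN j) _)) (Real.exp_pos _).le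
    rw [← expMajorant_mul, mul_comm _ a]
    exact expMajorant_mono (by linarith)
      (by linarith [norm_nonneg (PowerSeries.constantCoeff (MvPowerSeries.coeff k H))]) _
      (norm_nonneg _)
  choose q hq hqb using key
  exact ⟨q, hq, hqb⟩

theorem IsTermFamily.hasSum (hq : IsTermFamily A ρ τ a b N H φ q) (ha : 0 ≤ a) (hb : 0 ≤ b)
    (hN : ∀ j, 0 ≤ N j) {ζ : ℂ} (hζ : ζ ∈ sector ρ A) :
    HasSum (fun k => q k ζ) (∑' k, q k ζ) :=
  (Summable.of_norm_bounded ((summable_termMajorant ha hb hN (norm_nonneg ζ)).mul_right _)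
    fun k => hq.bound k ζ hζ).hasSum

theorem IsTermFamily.norm_sum_le (hq : IsTermFamily A ρ τ a b N H φ q) (ha : 0 ≤ a) (hb : 0 ≤ b)
    (hN : ∀ j, 0 ≤ N j) {ζ : ℂ} (hζ : ζ ∈ sector ρ A) (s : Finset (Fin r →₀ ℕ)) :
    ‖∑ k ∈ s, q k ζ‖ ≤ a * (1 + b * ∑ j, N j) * Real.exp ((τ + b * ∑ j, N j) * ‖ζ‖) := by
  calc ‖∑ k ∈ s, q k ζ‖ ≤ ∑ k ∈ s, termMajorant a b N k ‖ζ‖ * Real.exp (τ * ‖ζ‖) :=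
        norm_sum_le_of_le _ fun k _ => hq.bound k ζ hζ
    _ ≤ (a * (1 + b * ∑ j, N j) * Real.exp (b * (∑ j, N j) * ‖ζ‖)) * Real.exp (τ * ‖ζ‖) := by
        rw [← Finset.sum_mul]
        exact mul_le_mul_of_nonneg_right (sum_termMajorant_le ha hb hN (norm_nonneg _) s)
          (Real.exp_pos _).le
    _ = _ := by
        rw [mul_assoc _ (Real.exp _), ← Real.exp_add]
        ring_nf

/-- The Borel transform of `H(φ₁, …, φ_r)` is the sum of those of its terms. -/
theorem IsTermFamily.isBoundedExtension (hq : IsTermFamily A ρ τ a b N H φ q) (hA : IsOpen A)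
    (hρ : 0 < ρ) (ha : 0 ≤ a) (hb : 0 ≤ b) (hN : ∀ j, 0 ≤ N j)
    (hφ0 : ∀ j, PowerSeries.constantCoeff (φ j) = 0) :
    IsBoundedExtension A ρ (τ + b * ∑ j, N j) (formalSubst H φ) (fun ζ => ∑' k, q k ζ)
      (a * (1 + b * ∑ j, N j)) where
  ext := by
    have hU := isOpen_sector ρ hA
    have hopen : ∀ R : ℝ, IsOpen (sector ρ A ∩ Metric.ball 0 R) := fun R =>
      hU.inter Metric.isOpen_ball
    have hle : ∀ R : ℝ, ∀ k, ∀ ζ ∈ sector ρ A ∩ Metric.ball 0 R,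
        ‖q k ζ‖ ≤ termMajorant a b N k R * Real.exp (|τ| * R) := by
      intro R k ζ hζ
      have hR : ‖ζ‖ ≤ R := (mem_ball_zero_iff.1 hζ.2).le
      refine (hq.bound k ζ hζ.1).trans (mul_le_mul
        (termMajorant_mono ha hb hN k (norm_nonneg _) hR) (Real.exp_le_exp.2 ?_)
        (Real.exp_pos _).le (termMajorant_nonneg ha hb hN k ((norm_nonneg _).trans hR)))
      exact (mul_le_mul_of_nonneg_right (le_abs_self τ) (norm_nonneg _)).trans
        (mul_le_mul_of_nonneg_left hR (abs_nonneg τ))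
    have hdiff : ∀ R : ℝ, ∀ k, DifferentiableOn ℂ (q k) (sector ρ A ∩ Metric.ball 0 R) :=
      fun R k => (hq.ext k).1.mono inter_subset_left
    rw [isBorelExtension_iff hρ]
    constructor
    · intro ζ hζ
      have hR : 0 ≤ ‖ζ‖ + 1 := by positivity
      have hmem : ζ ∈ sector ρ A ∩ Metric.ball 0 (‖ζ‖ + 1) := ⟨hζ, by simp⟩
      exact ((Complex.differentiableOn_tsum_of_summable_norm
        ((summable_termMajorant ha hb hN hR).mul_right _) (hdiff _) (hopen _)
        (hle _)).differentiableAt ((hopen _).mem_nhds hmem)).differentiableWithinAt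
    · intro n
      have h1 := hasSum_iteratedDeriv_of_summable_norm
        ((summable_termMajorant ha hb hN zero_le_one).mul_right _) (hdiff 1) (hopen 1) (hle 1)
        ⟨zero_mem_sector hρ A, Metric.mem_ball_self one_pos⟩ n
      have h2 := hasSum_coeff_formalSubst hφ0 H (n + 1)
      simp only [((isBorelExtension_iff hρ).1 (hq.ext _)).2] at h1
      exact h1.unique h2
  bound ζ hζ := le_of_tendsto (hq.hasSum ha hb hN hζ).norm
    (Eventually.of_forall fun s => hq.norm_sum_le ha hb hN hζ s)

/-- The Borel sum of `H(φ₁, …, φ_r)` is the sum of those of its terms, by dominated convergence. -/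
theorem IsTermFamily.hasSum_laplaceSum (hq : IsTermFamily A ρ τ a b N H φ q) (hA : IsOpen A)
    (hρ : 0 < ρ) (ha : 0 ≤ a) (hb : 0 ≤ b) (hN : ∀ j, 0 ≤ N j)
    (hφ0 : ∀ j, PowerSeries.constantCoeff (φ j) = 0) (hθ : θ ∈ A)
    (hz : z ∈ halfPlane (τ + b * ∑ j, N j) θ)
    (hint : ∀ k : Fin r →₀ ℕ,
      IntegrableOn (laplaceIntegrand A (MvPowerSeries.coeff k H * ∏ j, φ j ^ k j) θ z) (Ioi 0)) :
    HasSum (fun k : Fin r →₀ ℕ => laplaceSum A (MvPowerSeries.coeff k H * ∏ j, φ j ^ k j) θ z)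
      (laplaceSum A (formalSubst H φ) θ z) := by
  have hext := (hq.isBoundedExtension hA hρ ha hb hN hφ0).ext
  have hconst := hasSum_coeff_formalSubst hφ0 H 0
  simp only [PowerSeries.coeff_zero_eq_constantCoeff_apply] at hconst
  refine hconst.add ?_
  set e : ℂ := Complex.exp ((θ : ℂ) * Complex.I) with he
  have hre : ∀ r' : ℝ, (-z * (r' * e)).re = -(r' * (z * e).re) := fun r' => by
    rw [show -z * ((r' : ℂ) * e) = -((r' : ℂ) * (z * e)) by ring, Complex.neg_re,
      Complex.re_ofReal_mul]
  have hsum : ∀ s : Finset (Fin r →₀ ℕ),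
      ∫ x in Ioi (0 : ℝ), ∑ k ∈ s, laplaceIntegrand A
        (MvPowerSeries.coeff k H * ∏ j, φ j ^ k j) θ z x =
      ∑ k ∈ s, ∫ x in Ioi (0 : ℝ), laplaceIntegrand A
        (MvPowerSeries.coeff k H * ∏ j, φ j ^ k j) θ z x := fun s =>
    integral_finsetSum _ fun k _ => hint k
  have hlim := tendsto_integral_filter_of_dominated_convergence (l := atTop)
    (μ := volume.restrict (Ioi (0 : ℝ)))
    (F := fun (s : Finset (Fin r →₀ ℕ)) x => ∑ k ∈ s, laplaceIntegrand A
        (MvPowerSeries.coeff k H * ∏ j, φ j ^ k j) θ z x)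
    (f := laplaceIntegrand A (formalSubst H φ) θ z)
    (fun x => a * (1 + b * ∑ j, N j) * Real.exp ((τ + b * ∑ j, N j - (z * e).re) * x))
    (Eventually.of_forall fun s =>
      (integrable_finsetSum s fun k _ => hint k).aestronglyMeasurable)
    (Eventually.of_forall fun s => ?_)
    ((integrableOn_exp_mul_Ioi (sub_neg.2 hz) 0).const_mul _) ?_
  · simp only [hsum] at hlim
    exact hlim
  · filter_upwards [ae_restrict_mem measurableSet_Ioi] with x hx
    have hx' : (0 : ℝ) < x := hx
    have hmem := ray_mem_sector (ρ := ρ) hθ hx'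
    simp only [laplaceIntegrand, (hq.ext _).borelTransform_ray hA hρ hθ hx', ← Finset.sum_mul]
    rw [norm_mul, norm_mul, Complex.norm_exp_ofReal_mul_I, mul_one, Complex.norm_exp, ← he, hre]
    refine (mul_le_mul_of_nonneg_right (hq.norm_sum_le ha hb hN hmem s)
      (Real.exp_pos _).le).trans_eq ?_
    rw [norm_ray hx'.le, mul_assoc _ (Real.exp _), ← Real.exp_add]
    ring_nf
  · filter_upwards [ae_restrict_mem measurableSet_Ioi] with x hx
    have hx' : (0 : ℝ) < x := hx
    have hmem := ray_mem_sector (ρ := ρ) hθ hx'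
    simp only [laplaceIntegrand, (hq.ext _).borelTransform_ray hA hρ hθ hx',
      hext.borelTransform_ray hA hρ hθ hx']
    exact ((hq.hasSum ha hb hN hmem).mul_right _).mul_right _

end

/-! ### Holomorphy in several variables and the substitution theorem -/

section

section SeveralVariables

variable {E : Type*} [NormedAddCommGroup E] [NormedSpace ℂ E]

/-- Cauchy's estimate for the derivative of a holomorphic function of several variables, obtained
by restriction to complex lines. -/
theorem norm_fderiv_le_of_forall_mem_closedBall {F : E → ℂ} {V : Set E} (hV : IsOpen V)
    (hF : DifferentiableOn ℂ F V) {C ε : ℝ} (hε : 0 < ε) (hC : ∀ y ∈ V, ‖F y‖ ≤ C) {y : E}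
    (hy : Metric.closedBall y ε ⊆ V) : ‖fderiv ℂ F y‖ ≤ C / ε := by
  have hyV : y ∈ V := hy (Metric.mem_closedBall_self hε.le)
  have hC0 : 0 ≤ C := (norm_nonneg _).trans (hC y hyV)
  refine ContinuousLinearMap.opNorm_le_bound _ (by positivity) fun v => ?_
  rcases eq_or_ne v 0 with rfl | hv
  · simp
  have hv' : 0 < ‖v‖ := norm_pos_iff.2 hv
  have hmem : ∀ t ∈ Metric.closedBall (0 : ℂ) (ε / ‖v‖), y + t • v ∈ V := by
    intro t ht
    refine hy ?_
    rw [mem_closedBall_zero_iff, le_div_iff₀ hv'] at ht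
    rw [mem_closedBall_iff_norm, add_sub_cancel_left, norm_smul]
    exact ht
  have hline : Differentiable ℂ fun t : ℂ => y + t • v := by fun_prop
  have hcomp : DifferentiableOn ℂ (fun t : ℂ => F (y + t • v))
      (Metric.closedBall (0 : ℂ) (ε / ‖v‖)) :=
    hF.comp hline.differentiableOn hmem
  have h1 := Complex.norm_deriv_le_of_forall_mem_sphere_norm_le (div_pos hε hv')
    (hcomp.diffContOnCl_ball subset_rfl)
    fun t ht => hC _ (hmem t (Metric.sphere_subset_closedBall ht))
  have h2 : HasDerivAt (fun t : ℂ => F (y + t • v)) (fderiv ℂ F y v) 0 := by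
    have hd : HasDerivAt (fun t : ℂ => y + t • v) v 0 := by
      simpa using ((hasDerivAt_id (0 : ℂ)).smul_const v).const_add y
    have hFd : HasFDerivAt F (fderiv ℂ F y) (y + (0 : ℂ) • v) := by
      simpa using (hF.differentiableAt (hV.mem_nhds hyV)).hasFDerivAt
    exact hFd.comp_hasDerivAt 0 hd
  rw [h2.deriv, div_div_eq_mul_div] at h1
  refine h1.trans_eq ?_
  ring

/-- The Weierstrass theorem on series of holomorphic functions, in several variables. -/
theorem differentiableOn_tsum_of_summable_norm_of_isOpen {ι : Type*} {F : ι → E → ℂ} {V : Set E}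
    {u : ι → ℝ} (hu : Summable u) (hV : IsOpen V) (hF : ∀ i, DifferentiableOn ℂ (F i) V)
    (hle : ∀ i, ∀ y ∈ V, ‖F i y‖ ≤ u i) : DifferentiableOn ℂ (fun y => ∑' i, F i y) V := by
  intro x hx
  obtain ⟨ε, hε, hεV⟩ := Metric.isOpen_iff.1 hV x hx
  have hε2 : 0 < ε / 2 := by positivity
  have hball : ∀ y ∈ Metric.ball x (ε / 2), y ∈ V := fun y hy =>
    hεV (Metric.ball_subset_ball (by linarith) hy)
  refine (hasFDerivAt_tsum_of_isPreconnected (hu.div_const (ε / 4)) Metric.isOpen_ball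
    (convex_ball x (ε / 2)).isPreconnected (f' := fun i y => fderiv ℂ (F i) y)
    (fun i y hy => ((hF i).differentiableAt (hV.mem_nhds (hball y hy))).hasFDerivAt)
    (fun i y hy => ?_) (Metric.mem_ball_self hε2)
    (Summable.of_norm_bounded hu fun i => hle i x hx)
    (Metric.mem_ball_self hε2)).differentiableAt.differentiableWithinAt
  refine norm_fderiv_le_of_forall_mem_closedBall hV (hF i) (by positivity) (hle i) ?_
  intro w hw
  refine hεV ?_
  rw [Metric.mem_ball] at hy ⊢
  rw [Metric.mem_closedBall] at hw
  linarith [dist_triangle w y x]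

end SeveralVariables

variable {A : Set ℝ} {ρ ρ₀ τ τ₀ τ' a b θ : ℝ} {r : ℕ} {φ : Fin r → ℂ⟦X⟧}
  {f : Fin r → ℂ → ℂ} {N : Fin r → ℝ} {z : ℂ} {H : MvPowerSeries (Fin r) ℂ⟦X⟧}

theorem summable_prod_pow {x : Fin r → ℝ} (h0 : ∀ j, 0 ≤ x j) (h1 : ∀ j, x j < 1) :
    Summable fun k : Fin r →₀ ℕ => ∏ j, x j ^ k j := by
  classical
  refine summable_of_sum_le (c := ∏ j, (1 - x j)⁻¹)
    (fun k => Finset.prod_nonneg fun j _ => pow_nonneg (h0 j) _) fun s => ?_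
  have hinj : ∑ k ∈ s, ∏ j, x j ^ k j =
      ∑ k ∈ s.image (fun k : Fin r →₀ ℕ => ⇑k), ∏ j, x j ^ k j := by
    rw [Finset.sum_image DFunLike.coe_injective.injOn]
  set t : Fin r → Finset ℕ := fun j => s.image fun k => k j with ht
  have hsub : s.image (fun k : Fin r →₀ ℕ => ⇑k) ⊆ Fintype.piFinset t := by
    intro k hk
    obtain ⟨k', hk', rfl⟩ := Finset.mem_image.1 hk
    exact Fintype.mem_piFinset.2 fun j => Finset.mem_image_of_mem _ hk'
  rw [hinj]
  refine (Finset.sum_le_sum_of_subset_of_nonneg hsub fun k _ _ =>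
    Finset.prod_nonneg fun j _ => pow_nonneg (h0 j) _).trans ?_
  rw [← Finset.prod_univ_sum t fun j n => x j ^ n]
  exact Finset.prod_le_prod (fun j _ => Finset.sum_nonneg fun n _ => pow_nonneg (h0 j) _)
    fun j _ => sum_le_hasSum _ (fun n _ => pow_nonneg (h0 j) _)
      (hasSum_geometric_of_lt_one (h0 j) (h1 j))

/-- A series `H` whose coefficients have bounded extensions with `‖H_k‖ ≤ a b^|k|`. -/
def HasGeometricBound (A : Set ℝ) (ρ τ a b : ℝ) (H : MvPowerSeries (Fin r) ℂ⟦X⟧) : Prop :=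
  ∀ k : Fin r →₀ ℕ, ∃ h β, IsBoundedExtension A ρ τ (MvPowerSeries.coeff k H) h β ∧ 0 ≤ β ∧
    ‖PowerSeries.constantCoeff (MvPowerSeries.coeff k H)‖ + β ≤ a * b ^ (∑ j, k j)

theorem HasGeometricBound.mono (hH : HasGeometricBound A ρ τ a b H) (hρ : ρ₀ ≤ ρ) (hτ : τ ≤ τ₀) :
    HasGeometricBound A ρ₀ τ₀ a b H := fun k =>
  let ⟨h, β, hh, hβ, hle⟩ := hH k
  ⟨h, β, hh.mono hβ hρ hτ, hβ, hle⟩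

theorem HasGeometricBound.borelSumWellDefined (hH : HasGeometricBound A ρ τ a b H) (hA : IsOpen A)
    (hA' : A.OrdConnected) (hρ : 0 < ρ) (k : Fin r →₀ ℕ) :
    BorelSumWellDefined A τ (MvPowerSeries.coeff k H) :=
  let ⟨_, _, hh, hβ, _⟩ := hH k
  hh.borelSumWellDefined hA hA' hρ hβ

theorem HasGeometricBound.norm_laplaceSum_le (hH : HasGeometricBound A ρ τ a b H) (hA : IsOpen A)
    (hρ : 0 < ρ) (hθ : θ ∈ A) {δ : ℝ} (hδ : 0 < δ) (hz : z ∈ halfPlane (τ + δ) θ)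
    (k : Fin r →₀ ℕ) :
    ‖laplaceSum A (MvPowerSeries.coeff k H) θ z‖ ≤ (1 + 1 / δ) * (a * b ^ (∑ j, k j)) := by
  obtain ⟨h, β, hh, hβ, hle⟩ := hH k
  have hz' : δ ≤ (z * Complex.exp ((θ : ℂ) * Complex.I)).re - τ := by
    have : τ + δ < (z * Complex.exp ((θ : ℂ) * Complex.I)).re := hz
    linarith
  have h1 := hh.norm_integral_laplaceIntegrand_le hA hρ hθ (halfPlane_anti (by linarith) θ hz)
  have h2 : β / ((z * Complex.exp ((θ : ℂ) * Complex.I)).re - τ) ≤ β / δ :=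
    div_le_div_of_nonneg_left hβ hδ hz'
  have h3 := norm_nonneg (PowerSeries.constantCoeff (MvPowerSeries.coeff k H))
  have h4 : β / δ ≤ 1 / δ * (a * b ^ (∑ j, k j)) := by
    rw [one_div_mul_eq_div]
    exact div_le_div_of_nonneg_right (by linarith) hδ.le
  unfold laplaceSum
  refine (norm_add_le _ _).trans ?_
  linarith

theorem HasGeometricBound.norm_laplaceSum_mul_prod_le (hH : HasGeometricBound A ρ τ a b H)
    (hA : IsOpen A) (hρ : 0 < ρ) (ha : 0 ≤ a) (hb : 0 ≤ b) (hθ : θ ∈ A) {δ R : ℝ} (hδ : 0 < δ)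
    (hz : z ∈ halfPlane (τ + δ) θ) {w : Fin r → ℂ} (hw : ∀ j, ‖w j‖ ≤ R) (k : Fin r →₀ ℕ) :
    ‖laplaceSum A (MvPowerSeries.coeff k H) θ z * ∏ j, w j ^ k j‖ ≤
      (1 + 1 / δ) * a * ∏ j, (b * R) ^ k j := by
  have h1 := hH.norm_laplaceSum_le hA hρ hθ hδ hz k
  have h2 : ‖∏ j, w j ^ k j‖ ≤ ∏ j, R ^ k j := by
    rw [norm_prod]
    exact Finset.prod_le_prod (fun j _ => norm_nonneg _) fun j _ => by
      rw [norm_pow]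
      exact pow_le_pow_left₀ (norm_nonneg _) (hw j) _
  rw [norm_mul]
  refine (mul_le_mul h1 h2 (norm_nonneg _) (by positivity)).trans_eq ?_
  simp only [mul_pow, Finset.prod_mul_distrib, Finset.prod_pow_eq_pow_sum]
  ring

theorem exists_mem_halfPlane_add (hz : z ∈ halfPlane τ θ) : ∃ δ > 0, z ∈ halfPlane (τ + δ) θ := by
  have hz' : τ < (z * Complex.exp ((θ : ℂ) * Complex.I)).re := hz
  obtain ⟨t, h1, h2⟩ := exists_between hz'
  exact ⟨t - τ, by linarith, by rw [add_sub_cancel]; exact h2⟩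

theorem exists_norm_le_of_mem_polydisc {R' : ℝ} (hR' : 0 < R') {w : Fin r → ℂ}
    (hw : w ∈ polydisc r R') : ∃ R, 0 ≤ R ∧ R < R' ∧ ‖w‖ < R := by
  obtain ⟨R, h1, h2⟩ := exists_between ((pi_norm_lt_iff hR').2 hw)
  exact ⟨R, (norm_nonneg w).trans h1.le, h2, h1⟩

theorem HasGeometricBound.summable_borelSumTerm (hH : HasGeometricBound A ρ τ a b H)
    (hA : IsOpen A) (hA' : A.OrdConnected) (hρ : 0 < ρ) (ha : 0 ≤ a) (hb : 0 < b) {q : ℂ × ℝ}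
    (hq : q ∈ sumDomain A τ) {w : Fin r → ℂ} (hw : w ∈ polydisc r (1 / b)) :
    Summable (borelSumTerm A τ H q w) := by
  obtain ⟨θ, hθ, z, hz, rfl⟩ : ∃ θ ∈ A, ∃ z ∈ halfPlane τ θ, chart τ θ z = q := by
    simpa [sumDomain] using hq
  obtain ⟨δ, hδ, hzδ⟩ := exists_mem_halfPlane_add hz
  obtain ⟨R, hR0, hRb, hwR⟩ := exists_norm_le_of_mem_polydisc (by positivity) hw
  have hbR : b * R < 1 := by rwa [lt_div_iff₀ hb, mul_comm] at hRb
  refine Summable.of_norm_bounded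
    ((summable_prod_pow (x := fun _ => b * R) (fun _ => by positivity) fun _ => hbR).mul_left
      ((1 + 1 / δ) * a)) fun k => ?_
  unfold borelSumTerm
  rw [(hH.borelSumWellDefined hA hA' hρ k θ hθ z hz).2]
  exact hH.norm_laplaceSum_mul_prod_le hA hρ ha hb.le hθ hδ hzδ
    (fun j => (norm_le_pi_norm w j).trans hwR.le) k

theorem HasGeometricBound.holomorphicOn_borelSumSeries (hH : HasGeometricBound A ρ τ a b H)
    (hA : IsOpen A) (hA' : A.OrdConnected) (hρ : 0 < ρ) (ha : 0 ≤ a) (hb : 0 < b) :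
    HolomorphicOnSumDomainProd A τ (polydisc r (1 / b)) (borelSumSeries A τ H) := by
  intro θ hθ
  have hcongr : EqOn (fun p : ℂ × (Fin r → ℂ) => borelSumSeries A τ H (chart τ θ p.1) p.2)
      (fun p => ∑' k : Fin r →₀ ℕ,
        laplaceSum A (MvPowerSeries.coeff k H) θ p.1 * ∏ j, p.2 j ^ k j)
      (halfPlane τ θ ×ˢ polydisc r (1 / b)) := by
    intro p hp
    simp only [borelSumSeries, borelSumTerm]
    refine tsum_congr fun k => ?_
    rw [(hH.borelSumWellDefined hA hA' hρ k θ hθ p.1 hp.1).2]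
  refine DifferentiableOn.congr ?_ hcongr
  rintro ⟨z, w⟩ ⟨hz, hw⟩
  obtain ⟨δ, hδ, hzδ⟩ := exists_mem_halfPlane_add hz
  obtain ⟨R, hR0, hRb, hwR⟩ := exists_norm_le_of_mem_polydisc (by positivity) hw
  have hbR : b * R < 1 := by rwa [lt_div_iff₀ hb, mul_comm] at hRb
  have hV : IsOpen (halfPlane (τ + δ) θ ×ˢ Metric.ball (0 : Fin r → ℂ) R) :=
    (isOpen_halfPlane _ _).prod Metric.isOpen_ball
  refine ((differentiableOn_tsum_of_summable_norm_of_isOpen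
    ((summable_prod_pow (x := fun _ => b * R) (fun _ => by positivity) fun _ => hbR).mul_left
      ((1 + 1 / δ) * a)) hV (fun k => ?_) fun k p hp => ?_).differentiableAt
    (hV.mem_nhds ⟨hzδ, mem_ball_zero_iff.2 hwR⟩)).differentiableWithinAt
  · obtain ⟨h, β, hh, hβ, -⟩ := hH k
    have hw : Differentiable ℂ fun p : ℂ × (Fin r → ℂ) => ∏ j, p.2 j ^ k j := fun p =>
      (HasFDerivAt.finsetProd fun j _ =>
        (show DifferentiableAt ℂ (fun p : ℂ × (Fin r → ℂ) => p.2 j ^ k j) p by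
          fun_prop).hasFDerivAt).differentiableAt
    refine DifferentiableOn.mul ?_ hw.differentiableOn
    exact (hh.differentiableOn_laplaceSum hA hρ hβ hθ).comp differentiableOn_fst
      fun p hp => halfPlane_anti (by linarith) θ hp.1
  · exact hH.norm_laplaceSum_mul_prod_le hA hρ ha hb.le hθ hδ hp.1
      (fun j => (norm_le_pi_norm p.2 j).trans (mem_ball_zero_iff.1 hp.2).le) k

/-- Substitution into a series with a geometric bound, when the norms are finite. The level `τ` at
which the Borel sums of the coefficients are taken may be lower than the level `τ₀` of the
norms. -/
theorem HasGeometricBound.borelSumCommutesWithSubst (hH : HasGeometricBound A ρ τ₀ a b H)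
    (hwd : ∀ k : Fin r →₀ ℕ, BorelSumWellDefined A τ (MvPowerSeries.coeff k H))
    (hA : IsOpen A) (hA' : A.OrdConnected) (hρ : 0 < ρ) (ha : 0 ≤ a) (hb : 0 < b)
    (hφ : ∀ j, IsBoundedExtension A ρ τ₀ (φ j) (f j) (N j)) (hN : ∀ j, 0 ≤ N j)
    (hφ0 : ∀ j, PowerSeries.constantCoeff (φ j) = 0) (hτ : τ ≤ τ₀)
    (hτ' : τ₀ + b * ∑ j, N j ≤ τ') : BorelSumCommutesWithSubst A b τ τ' H φ := by
  obtain ⟨q, hq⟩ := exists_isTermFamily hA hρ hH hφ hN hφ0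
  have hsum : 0 ≤ b * ∑ j, N j := mul_nonneg hb.le (Finset.sum_nonneg fun j _ => hN j)
  have hττ' : τ ≤ τ' := by linarith
  have hC : 0 ≤ a * (1 + b * ∑ j, N j) := by positivity
  have hφwd : ∀ j, BorelSumWellDefined A τ' (φ j) := fun j =>
    ((hφ j).mono (hN j) le_rfl (by linarith)).borelSumWellDefined hA hA' hρ (hN j)
  have hFwd : BorelSumWellDefined A τ' (formalSubst H φ) :=
    ((hq.isBoundedExtension hA hρ ha hb.le hN hφ0).mono hC le_rfl hτ').borelSumWellDefined
      hA hA' hρ hC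
  refine ⟨hττ', hφwd, hFwd, fun p hp => ?_⟩
  obtain ⟨θ, hθ, z, hz, rfl⟩ : ∃ θ ∈ A, ∃ z ∈ halfPlane τ' θ, chart τ' θ z = p := by
    simpa [sumDomain] using hp
  have hz0 : z ∈ halfPlane (τ₀ + b * ∑ j, N j) θ := halfPlane_anti hτ' θ hz
  have hz1 : z ∈ halfPlane τ₀ θ := halfPlane_anti (by linarith) θ hz
  rw [toLevel_chart hττ', (hFwd θ hθ z hz).2]
  simp only [(hφwd _ θ hθ z hz).2]
  constructor
  · intro j
    have h1 := (hφ j).norm_integral_laplaceIntegrand_le hA hρ hθ hz1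
    simp only [laplaceSum, hφ0 j, zero_add]
    refine h1.trans_lt ?_
    have hx : τ₀ + b * ∑ j, N j < (z * Complex.exp ((θ : ℂ) * Complex.I)).re := hz0
    have hj : b * N j ≤ b * ∑ j, N j := mul_le_mul_of_nonneg_left
      (Finset.single_le_sum (fun i _ => hN i) (Finset.mem_univ j)) hb.le
    rw [div_lt_div_iff₀ (by linarith) hb]
    linarith
  · have key : ∀ k : Fin r →₀ ℕ,
        IntegrableOn (laplaceIntegrand A (MvPowerSeries.coeff k H * ∏ j, φ j ^ k j) θ z) (Ioi 0) ∧
          laplaceSum A (MvPowerSeries.coeff k H * ∏ j, φ j ^ k j) θ z =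
            laplaceSum A (MvPowerSeries.coeff k H) θ z * ∏ j, laplaceSum A (φ j) θ z ^ k j := by
      intro k
      obtain ⟨h, β, hh, -, -⟩ := hH k
      exact laplaceSum_mul_prod_pow hA hρ hh hφ hN hφ0 hθ hz1 k
    have hs := hq.hasSum_laplaceSum hA hρ ha hb.le hN hφ0 hθ hz0 fun k => (key k).1
    rw [← hs.tsum_eq, borelSumSeries]
    refine tsum_congr fun k => ?_
    rw [(key k).2, borelSumTerm, (hwd k θ hθ z (halfPlane_anti hττ' θ hz)).2]

theorem exists_isBoundedExtension_toReal (hA : IsOpen A) (hρ : 0 < ρ) {ψ : ℂ⟦X⟧}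
    (hψ : borelNorm A ρ τ ψ ≠ ⊤) :
    ∃ g, IsBoundedExtension A ρ τ ψ g (borelNorm A ρ τ ψ).toReal := by
  obtain ⟨g, β, hg, -, hle⟩ := exists_isBoundedExtension hA hρ ENNReal.toReal_nonneg
    (ENNReal.ofReal_toReal hψ).ge
  exact ⟨g, hg.mono_bound (by linarith [norm_nonneg (PowerSeries.constantCoeff ψ)])⟩

theorem HasGeometricBound.borelNorm_formalSubst_le (hH : HasGeometricBound A ρ τ a b H)
    (hA : IsOpen A) (hρ : 0 < ρ) (ha : 0 ≤ a) (hb : 0 ≤ b)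
    (hφ : ∀ j, IsBoundedExtension A ρ τ (φ j) (f j) (N j)) (hN : ∀ j, 0 ≤ N j)
    (hφ0 : ∀ j, PowerSeries.constantCoeff (φ j) = 0) :
    borelNorm A ρ (τ + b * ∑ j, N j) (formalSubst H φ) ≤
      ENNReal.ofReal (a * (2 + b * ∑ j, N j)) := by
  obtain ⟨q, hq⟩ := exists_isTermFamily hA hρ hH hφ hN hφ0
  have hsum : 0 ≤ ∑ j, N j := Finset.sum_nonneg fun j _ => hN j
  refine ((hq.isBoundedExtension hA hρ ha hb hN hφ0).borelNorm_le (by positivity)).trans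
    (ENNReal.ofReal_le_ofReal ?_)
  -- Only `H_0` contributes to the constant term.
  have hconst : PowerSeries.constantCoeff (formalSubst H φ) =
      PowerSeries.constantCoeff (MvPowerSeries.coeff 0 H) := by
    have h := hasSum_coeff_formalSubst hφ0 H 0
    rw [← PowerSeries.coeff_zero_eq_constantCoeff_apply, ← h.tsum_eq, tsum_eq_single 0]
    · simp
    · intro k hk
      refine coeff_mul_prod_pow_eq_zero hφ0 _ (Nat.pos_of_ne_zero fun h0 => hk ?_)
      ext j
      exact (Finset.sum_eq_zero_iff.1 h0) j (Finset.mem_univ j)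
  obtain ⟨h, β, -, hβ, hle⟩ := hH 0
  have hle' : ‖PowerSeries.constantCoeff (MvPowerSeries.coeff 0 H)‖ + β ≤ a := by simpa using hle
  rw [hconst]
  linarith

end

end OneSummable

end

open OneSummable in
theorem theorem3 (A : Set ℝ) (hA_interval : A.OrdConnected) (hA_open : IsOpen A)
    (hA_nonempty : A.Nonempty) (r : ℕ) (H : MvPowerSeries (Fin r) (PowerSeries ℂ))
    (ρ a b τ : ℝ) (hρ : 0 < ρ) (ha : 0 < a) (hb : 0 < b)
    (hH_summable : ∀ k : Fin r →₀ ℕ, IsOneSummable A (MvPowerSeries.coeff k H))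
    (hH_bound : ∀ k : Fin r →₀ ℕ,
      borelNorm A ρ τ (MvPowerSeries.coeff k H) ≤ ENNReal.ofReal (a * b ^ (∑ j, k j))) :
    ((∀ k : Fin r →₀ ℕ, BorelSumWellDefined A τ (MvPowerSeries.coeff k H)) ∧
      (∀ q ∈ sumDomain A τ, ∀ w ∈ polydisc r (1 / b), Summable (borelSumTerm A τ H q w)) ∧
      HolomorphicOnSumDomainProd A τ (polydisc r (1 / b)) (borelSumSeries A τ H)) ∧
    ∀ φ : Fin r → PowerSeries ℂ, (∀ j, IsOneSummable A (φ j)) →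
      (∀ j, PowerSeries.constantCoeff (φ j) = 0) →
      IsOneSummable A (formalSubst H φ) ∧
      (∃ T : ℝ, ∀ τ' : ℝ, T ≤ τ' → BorelSumCommutesWithSubst A b τ τ' H φ) ∧
      ((∀ j, borelNorm A ρ τ (φ j) ≠ ⊤) →
        ∀ N τ' : ℝ, N = ∑ j, (borelNorm A ρ τ (φ j)).toReal → τ' = τ + b * N →
          BorelSumCommutesWithSubst A b τ τ' H φ ∧
          borelNorm A ρ τ' (formalSubst H φ) ≤ ENNReal.ofReal (a * (2 + b * N))) := by
  have hH : HasGeometricBound A ρ τ a b H := fun k =>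
    exists_isBoundedExtension hA_open hρ (by positivity) (hH_bound k)
  have hwd := hH.borelSumWellDefined hA_open hA_interval hρ
  refine ⟨⟨hwd, fun q hq w hw =>
    hH.summable_borelSumTerm hA_open hA_interval hρ ha.le hb hq hw,
    hH.holomorphicOn_borelSumSeries hA_open hA_interval hρ ha.le hb⟩, fun φ hφ hφ0 => ?_⟩
  have key : ∃ ρ₀ > 0, ρ₀ ≤ ρ ∧ ∃ τ₀ ≥ τ, ∃ (f : Fin r → ℂ → ℂ) (N : Fin r → ℝ),
      (∀ j, IsBoundedExtension A ρ₀ τ₀ (φ j) (f j) (N j)) ∧ ∀ j, 0 ≤ N j := by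
    choose ρ₁ hρ₁ f hf τ₁ C hC hfb using hφ
    obtain ⟨ρ₀, ⟨hρ₀, hρ₀'⟩, hpos⟩ := (((Filter.eventually_all.2 fun j =>
      Ioo_mem_nhdsGT (hρ₁ j)).and (Ioo_mem_nhdsGT hρ)).and
      self_mem_nhdsWithin : ∀ᶠ x in 𝓝[>] (0 : ℝ), ((∀ j, x ∈ Set.Ioo 0 (ρ₁ j)) ∧
        x ∈ Set.Ioo 0 ρ) ∧ x ∈ Set.Ioi 0).exists
    obtain ⟨τ₀, hτ₀, hτ₀'⟩ := ((Filter.eventually_all.2 fun j =>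
      Filter.eventually_ge_atTop (τ₁ j)).and (Filter.eventually_ge_atTop τ)).exists
    exact ⟨ρ₀, hpos, hρ₀'.2.le, τ₀, hτ₀', f, C, fun j =>
      (IsBoundedExtension.mk (hf j) (hfb j)).mono (hC j).le (hρ₀ j).2.le (hτ₀ j),
      fun j => (hC j).le⟩
  obtain ⟨ρ₀, hρ₀, hρρ₀, τ₀, hττ₀, f, N, hf, hN⟩ := key
  have hH₀ := hH.mono hρρ₀ hττ₀
  refine ⟨?_, ⟨τ₀ + b * ∑ j, N j, fun τ' hτ' => hH₀.borelSumCommutesWithSubst hwd hA_open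
    hA_interval hρ₀ ha.le hb hf hN hφ0 hττ₀ hτ'⟩, ?_⟩
  · obtain ⟨q, hq⟩ := exists_isTermFamily hA_open hρ₀ hH₀ hf hN hφ0
    have hext := hq.isBoundedExtension hA_open hρ₀ ha.le hb.le hN hφ0
    have : 0 ≤ ∑ j, N j := Finset.sum_nonneg fun j _ => hN j
    exact ⟨ρ₀, hρ₀, _, hext.ext, _, _, by positivity, hext.bound⟩
  · rintro hfin N' τ' rfl rfl
    choose g hg using fun j => exists_isBoundedExtension_toReal hA_open hρ (hfin j)
    exact ⟨hH.borelSumCommutesWithSubst hwd hA_open hA_interval hρ ha.le hb hg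
      (fun j => ENNReal.toReal_nonneg) hφ0 le_rfl le_rfl,
      hH.borelNorm_formalSubst_le hA_open hρ ha.le hb.le hg (fun j => ENNReal.toReal_nonneg) hφ0⟩
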